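/- **Corollary.** *Definitions.* For a closed set $Y\subseteq\mathbb R$, a *$Y$-interval* is a component of $Y$ with more than one point; $\mathcal I_Y$ denotes the family of all $Y$-intervals, ordered by $I<J$ iff $x<y$ for all $x\in I$, $y\in J$, and given the order topology. $\mathcal I_Y^{(\alpha)}$ is its derived set of order $\alpha$: $\mathcal I_Y^{(0)}=\mathcal I_Y$, $\mathcal I_Y^{(\alpha+1)}$ is the derived set (set of accumulation points) of $\mathcal I_Y^{(\alpha)}$, and $\mathcal I_Y^{(\alpha)}=\bigcap_{\beta<\alpha}\mathcal I_Y^{(\beta)}$ for limit $\alpha$. A set $Y\subseteq\mathbb R$ is *regularly closed* if it is closed and the union of all $Y$-intervals is dense in $Y$. A set $A\subseteq\mathbb R$ is a *t$\mathbb R$-set* if for every $Y\subseteq\mathbb R$ homeomorphic to $A$ there is a homeomorphism $f\colon\mathbb R\to\mathbb R$ with $f[A]=Y$. For ordered spaces $L_1,L_2,\dots$ let $\Sigma(L_1,L_2,\dots)=\bigcup_{n\in\mathbb Z\setminus\{0\}}\{\tfrac1n\}\times L_{|n|}\;\cup\;\{0\}\times[0,1]$ with the lexicographic order. For each countable limit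 ordinal $\alpha$ fix a strictly increasing sequence $\alpha_1<\alpha_2<\cdots$ of ordinals that is cofinal in $\alpha$ (such sequences exist). Define ordered spaces $S_\alpha$, $\alpha<\omega_1$, by $S_0=[0,1]$, $S_{\alpha+1}=\Sigma(S_\alpha,S_\alpha,\dots)$, and $S_\alpha=\Sigma(S_{\alpha_1},S_{\alpha_2},\dots)$ for limit $\alpha$. Let $\mathbf X_\alpha$ denote a compact subset of $\mathbb R$ that is order isomorphic to $S_\alpha$. *Claim.* There are at least $\omega_1$ pairwise non-homeomorphic t$\mathbb R$-sets that are regularly closed compact subsets of $\mathbb R$. More precisely, for every choice of the cofinal sequences: for each $\alpha<\omega_1$ a set $\mathbf X_\alpha$ exists; every such $\mathbf X_\alpha$ is a regularly closed compact t$\mathbb R$-set, $\mathcal I_{\mathbf X_\alpha}^{(\alpha)}$ is a singleton, and $\mathcal I_{\mathbf X_\alpha}^{(\beta)}$ is infinite for every $\beta<\alpha$; and $\mathbf X_\alpha$, $\mathbf X_\beta$ are not homeomorphic whenever $\alpha\ne\beta$ are countable ordinals. -/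

import Mathlib

open Set Topology

noncomputable section

/-- The `Y`-intervals: the non-trivial (more than one point) components of `Y ⊆ ℝ`. -/
def yIntervals (Y : Set ℝ) : Set (Set ℝ) :=
  {I | I.Nontrivial ∧ ∃ x ∈ Y, I = connectedComponentIn Y x}

/-- `Y` is closed and the union of all `Y`-intervals is dense in `Y`. -/
def IsRegularlyClosed (Y : Set ℝ) : Prop :=
  IsClosed Y ∧ Y ⊆ closure (⋃₀ yIntervals Y)

/-- `A` is tame in `ℝ` (a tℝ-set): every homeomorphic copy `Y ⊆ ℝ` of `A` is the image of `A` under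
a homeomorphism of `ℝ`. -/
def IsTameInReal (A : Set ℝ) : Prop :=
  ∀ Y : Set ℝ, Nonempty (A ≃ₜ Y) → ∃ f : ℝ ≃ₜ ℝ, f '' A = Y

/-- The family of all `Y`-intervals, as a type (to be ordered and topologized). -/
def IntervalFamily (Y : Set ℝ) : Type := {I : Set ℝ // I ∈ yIntervals Y}

/-- `I < J` iff every point of `I` is less than every point of `J`. -/
instance (Y : Set ℝ) : PartialOrder (IntervalFamily Y) where
  le I J := I = J ∨ ∀ x ∈ I.1, ∀ y ∈ J.1, x < y
  lt I J := ∀ x ∈ I.1, ∀ y ∈ J.1, x < y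
  le_refl I := Or.inl rfl
  le_trans I J K := by
    rintro (rfl | h) (rfl | h')
    · exact Or.inl rfl
    · exact Or.inr h'
    · exact Or.inr h
    · obtain ⟨z, hz⟩ := J.2.1.nonempty
      exact Or.inr fun x hx y hy => (h x hx z hz).trans (h' z hz y hy)
  lt_iff_le_not_ge I J := by
    obtain ⟨x, hx⟩ := I.2.1.nonempty
    obtain ⟨y, hy⟩ := J.2.1.nonempty
    constructor
    · refine fun h => ⟨Or.inr h, ?_⟩
      rintro (rfl | h')
      · exact lt_irrefl _ (h x hx x hx)
      · exact lt_asymm (h x hx y hy) (h' y hy x hx)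
    · rintro ⟨rfl | h, h'⟩
      · exact absurd (Or.inl rfl) h'
      · exact h
  le_antisymm I J := by
    rintro (h | h) (h' | h')
    · exact h
    · exact h
    · exact h'.symm
    · obtain ⟨x, hx⟩ := I.2.1.nonempty
      obtain ⟨y, hy⟩ := J.2.1.nonempty
      exact absurd (h x hx y hy) (lt_asymm (h' y hy x hx))

/-- The order topology on the family of `Y`-intervals. -/
instance (Y : Set ℝ) : TopologicalSpace (IntervalFamily Y) :=
  Preorder.topology (IntervalFamily Y)

/-- The derived set of `E` of order `α`: `E^(0) = E`, `E^(α+1)` is the derived set of `E^(α)`, and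
`E^(α)` is the intersection of all `E^(β)`, `β < α`, for limit `α`. -/
def iteratedDerivedSet {T : Type} [TopologicalSpace T] (E : Set T) (α : Ordinal.{0}) : Set T :=
  Ordinal.limitRecOn α E (fun _ D => derivedSet D) (fun o _ ih => ⋂ β : Iio o, ih β.1 β.2)

/-- The `α`-th derivative of the family of `Y`-intervals with its order topology. -/
def intervalDerivative (Y : Set ℝ) (α : Ordinal.{0}) : Set (IntervalFamily Y) :=
  iteratedDerivedSet univ α

/-- The ordered space `L 0 + L 1 + L 2 + ⋯ + [0,1] + ⋯ + L 2 + L 1 + L 0`, i.e. the lexicographic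
sum over the index set `{1/n : n ∈ ℤ, n ≠ 0} ∪ {0} ⊆ ℝ` of the blocks `L (|n| - 1)` at `1/n` and
`[0,1]` at `0`. The negative indices `-1 < -1/2 < ⋯` have the order of `ℕ`, the positive ones that
of `ℕᵒᵈ`. -/
def twoSidedSum (L : ℕ → LinOrd.{0}) : LinOrd.{0} :=
  LinOrd.of ((Σₗ n : ℕ, L n) ⊕ₗ (Icc (0 : ℝ) 1 ⊕ₗ (Σₗ n : ℕᵒᵈ, L (OrderDual.ofDual n))))

/-- A choice, for every limit ordinal `α`, of a sequence of ordinals below `α`. -/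
abbrev LimitSequences : Type 1 :=
  ∀ α : Ordinal.{0}, Order.IsSuccLimit α → ℕ → Iio α

/-- The chosen sequences at countable limit ordinals `α` are strictly increasing and cofinal in
`α`. -/
def LimitSequences.IsFundamental (c : LimitSequences) : Prop :=
  ∀ (α : Ordinal.{0}) (hα : Order.IsSuccLimit α), α < Ordinal.omega 1 →
    StrictMono (c α hα) ∧ ∀ β < α, ∃ n, β < (c α hα n : Ordinal.{0})

/-- The ordered spaces `S_α([0,1])`: `S_0 = [0,1]`; `S_{α+1}` is the two-sided sum with all blocks
equal to `S_α`; for limit `α`, `S_α` is the two-sided sum with blocks `S_{c α n}`, `n ∈ ℕ`. -/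
def iteratedS (c : LimitSequences) (α : Ordinal.{0}) : LinOrd.{0} :=
  Ordinal.limitRecOn α (LinOrd.of (Icc (0 : ℝ) 1)) (fun _ L => twoSidedSum fun _ => L)
    (fun o ho ih => twoSidedSum fun n => ih (c o ho n).1 (c o ho n).2)

/-- `X` is a set `𝐗_α`: a compact subset of `ℝ` that is order isomorphic to `S_α([0,1])`. -/
def IsBoldX (c : LimitSequences) (α : Ordinal.{0}) (X : Set ℝ) : Prop :=
  IsCompact X ∧ Nonempty (X ≃o iteratedS c α)

end

/-! The order type `S_α` is replaced by an intrinsic rank. The components of a compact set receive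
ordinals so that all components are nondegenerate, those close to a given one have smaller rank, and
at each end of a component the ranks of the accumulating components are cofinal in its own. `HasRank
Z α` adds that the maximum `α` is attained on a single component. Both ends obey the same condition,
so the rank is blind to direction: a homeomorphism may permute or reverse pieces of the set and
still preserves it (`HasRank.of_homeomorph`).

For countable `α` the rank determines the order type. Next to an end of the maximal component, a
piece of any prescribed smaller rank can be cut off after any earlier cut, its last maximal
component absorbing everything before it. Hence each side is an `ω`-sequence of pieces with the
ranks prescribed by the definition of `S_α`, and induction gives an order isomorphism with `S_α`
(`HasRank.nonempty_orderIso_iteratedS`). Sets of every countable rank exist by placing smaller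
copies symmetrically around a segment (`exists_hasRank_of_cofinal`).

An order isomorphism of compact sets of reals extends to a homeomorphism of the line, affine on the
gaps (`exists_real_homeomorph_image_eq`). So every `𝐗_α` has rank `α`, and any homeomorphic copy of
it, again of rank `α`, is an image of it under a homeomorphism of the line: tameness. Finally the
`β`-th derivative of the interval family consists of the intervals of rank at least `β`
(`IsRanking.intervalDerivative_eq`); this yields the claims about derived sets and shows that the
rank is unique, which separates different `α`. -/

/-! ### Rankings of components and their localisation. -/

/-- Local conditions at `x` saying that `ρ` is a two-sided Cantor–Bendixson rank of the components
of `Z`: the component of `x` is non-trivial, `ρ` is constant on it, nearby components have smaller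
rank, and if `x` is an end point of its component, then the ranks of the components accumulating
at `x` are cofinal in `ρ x`. -/
structure RankedAt (Z : Set ℝ) (ρ : ℝ → Ordinal.{0}) (x : ℝ) : Prop where
  exists_ne : ∃ y, y ≠ x ∧ uIcc x y ⊆ Z
  const : ∀ y, uIcc x y ⊆ Z → ρ y = ρ x
  lt_near : ∀ᶠ y in 𝓝[Z] x, uIcc x y ⊆ Z ∨ ρ y < ρ x
  approx : x ∉ interior Z → ∀ δ < ρ x, ∃ᶠ y in 𝓝[Z] x, ¬ uIcc x y ⊆ Z ∧ δ ≤ ρ y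

/-- `ρ` is a two-sided Cantor–Bendixson rank of the components of the compact set `Z`. -/
structure IsRanking (Z : Set ℝ) (ρ : ℝ → Ordinal.{0}) : Prop where
  isCompact : IsCompact Z
  rankedAt : ∀ x ∈ Z, RankedAt Z ρ x

/-- `Z` carries a rank for which the maximal value `α` is attained on exactly one component. -/
def HasRank (Z : Set ℝ) (α : Ordinal.{0}) : Prop :=
  ∃ ρ, IsRanking Z ρ ∧ ∃ x ∈ Z, ρ x = α ∧ ∀ y ∈ Z, uIcc x y ⊆ Z ∨ ρ y < α

theorem HasRank.isCompact {Z : Set ℝ} {α : Ordinal.{0}} (h : HasRank Z α) : IsCompact Z := by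
  obtain ⟨ρ, hρ, -⟩ := h
  exact hρ.isCompact

theorem uIcc_subset_Ioo_of_notMem {Z : Set ℝ} {s t x y : ℝ} (hs : s ∉ Z) (ht : t ∉ Z)
    (hx : x ∈ Ioo s t) (hxy : uIcc x y ⊆ Z) : uIcc x y ⊆ Ioo s t := by
  have hy : y ∈ Ioo s t := by
    constructor
    · by_contra! h
      exact hs (hxy (mem_uIcc.2 (Or.inr ⟨h, hx.1.le⟩)))
    · by_contra! h
      exact ht (hxy (mem_uIcc.2 (Or.inl ⟨hx.2.le, h⟩)))
  exact ordConnected_Ioo.uIcc_subset hx hy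

/-- Being ranked at `x` only depends on the part of the set between two cuts around `x`. -/
theorem RankedAt.congr {Z Z' : Set ℝ} {ρ ρ' : ℝ → Ordinal.{0}} {s t x : ℝ}
    (h : RankedAt Z ρ x) (hxZ : x ∈ Z) (hx : x ∈ Ioo s t) (hs : s ∉ Z) (ht : t ∉ Z) (hs' : s ∉ Z')
    (ht' : t ∉ Z') (hZ : Z ∩ Ioo s t = Z' ∩ Ioo s t) (hρ : EqOn ρ ρ' (Z ∩ Ioo s t)) :
    RankedAt Z' ρ' x := by
  have key : ∀ y, uIcc x y ⊆ Z ↔ uIcc x y ⊆ Z' := by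
    intro y
    constructor
    · intro hy
      have := subset_inter hy (uIcc_subset_Ioo_of_notMem hs ht hx hy)
      exact (hZ ▸ this).trans inter_subset_left
    · intro hy
      have := subset_inter hy (uIcc_subset_Ioo_of_notMem hs' ht' hx hy)
      exact (hZ ▸ this).trans inter_subset_left
  -- The two sets agree on an open interval around `x`, so they have the same relative
  -- neighbourhoods there.
  have hn : 𝓝[Z] x = 𝓝[Z'] x := nhdsWithin_eq_nhdsWithin hx isOpen_Ioo hZ
  have hρx : ρ x = ρ' x := hρ ⟨hxZ, hx⟩
  have hev : ∀ᶠ y in 𝓝[Z] x, ρ y = ρ' y := by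
    filter_upwards [self_mem_nhdsWithin, mem_nhdsWithin_of_mem_nhds (isOpen_Ioo.mem_nhds hx)]
      with y h1 h2 using hρ ⟨h1, h2⟩
  have hint : x ∈ interior Z ↔ x ∈ interior Z' := by
    have h1 : interior Z ∩ Ioo s t = interior Z' ∩ Ioo s t := by
      have := congrArg interior hZ
      simpa [interior_inter] using this
    have h2 := Set.ext_iff.1 h1 x
    simpa [hx.1, hx.2] using h2
  refine ⟨?_, ?_, ?_, ?_⟩
  · simpa only [key] using h.exists_ne
  · intro y hy
    have hy' := (key y).2 hy
    rw [← hρx, ← h.const y hy', hρ ⟨hy' right_mem_uIcc,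
      uIcc_subset_Ioo_of_notMem hs ht hx hy' right_mem_uIcc⟩]
  · rw [← hn]
    filter_upwards [h.lt_near, hev] with y h1 h2
    rwa [← key, ← h2, ← hρx]
  · intro hxi δ hδ
    rw [← hn]
    refine ((h.approx (hint.not.2 hxi) δ (hρx ▸ hδ)).and_eventually hev).mono ?_
    rintro y ⟨⟨h1, h2⟩, h3⟩
    exact ⟨(key y).not.1 h1, h3 ▸ h2⟩

theorem IsRanking.inter_Ioo {Z : Set ℝ} {ρ : ℝ → Ordinal.{0}} {s t : ℝ} (h : IsRanking Z ρ)
    (hs : s ∉ Z) (ht : t ∉ Z) : IsRanking (Z ∩ Ioo s t) ρ := by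
  have hZ : Z ∩ Ioo s t = Z ∩ Icc s t := by
    ext y
    constructor
    · exact fun hy => ⟨hy.1, hy.2.1.le, hy.2.2.le⟩
    · exact fun hy => ⟨hy.1, lt_of_le_of_ne hy.2.1 fun e => hs (e ▸ hy.1),
        lt_of_le_of_ne hy.2.2 fun e => ht (e ▸ hy.1)⟩
  refine ⟨hZ ▸ h.isCompact.inter_right isClosed_Icc, fun x hx => ?_⟩
  refine (h.rankedAt x hx.1).congr hx.1 hx.2 hs ht (fun e => hs e.1) (fun e => ht e.1) ?_
    (fun _ _ => rfl)
  rw [inter_assoc, inter_self]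

/-! ### Topological invariance of the rank. -/

theorem mem_interior_iff_exists_Icc {Z : Set ℝ} {x : ℝ} :
    x ∈ interior Z ↔ ∃ u v, u < x ∧ x < v ∧ Icc u v ⊆ Z := by
  rw [mem_interior_iff_mem_nhds]
  constructor
  · intro h
    obtain ⟨ε, hε, hb⟩ := Metric.nhds_basis_closedBall.mem_iff.1 h
    rw [Real.closedBall_eq_Icc] at hb
    exact ⟨x - ε, x + ε, by linarith, by linarith, hb⟩
  · rintro ⟨u, v, hu, hv, h⟩
    exact Filter.mem_of_superset (Icc_mem_nhds hu hv) h

theorem uIcc_subset_of_continuousOn {Z Y : Set ℝ} {f : ℝ → ℝ} (hf : ContinuousOn f Z)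
    (hfY : MapsTo f Z Y) {x y : ℝ} (hxy : uIcc x y ⊆ Z) : uIcc (f x) (f y) ⊆ Y :=
  ((isPreconnected_uIcc.image f (hf.mono hxy)).ordConnected.uIcc_subset
    (mem_image_of_mem f left_mem_uIcc) (mem_image_of_mem f right_mem_uIcc)).trans
    ((hfY.mono_left hxy).image_subset)

/-- Invariance of domain in dimension one: an injective continuous map on a segment is strictly
monotone, so the image of an inner point stays strictly between the images of the end points. -/
theorem mem_interior_of_continuousOn_injOn {Z Y : Set ℝ} {f : ℝ → ℝ} (hf : ContinuousOn f Z)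
    (hfY : MapsTo f Z Y) (hi : InjOn f Z) {x : ℝ} (hx : x ∈ interior Z) : f x ∈ interior Y := by
  rw [mem_interior_iff_exists_Icc] at hx ⊢
  obtain ⟨u, v, hu, hv, h⟩ := hx
  have huv : u ≤ v := (hu.trans hv).le
  have hsub : uIcc (f u) (f v) ⊆ Y :=
    uIcc_subset_of_continuousOn hf hfY (by rwa [uIcc_of_le huv])
  have hmu : u ∈ Icc u v := left_mem_Icc.2 huv
  have hmv : v ∈ Icc u v := right_mem_Icc.2 huv
  have hmx : x ∈ Icc u v := ⟨hu.le, hv.le⟩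
  rcases (hf.mono h).strictMonoOn_of_injOn_Icc' huv (hi.mono h) with hm | hm
  · exact ⟨f u, f v, hm hmu hmx hu, hm hmx hmv hv, Icc_subset_uIcc.trans hsub⟩
  · exact ⟨f v, f u, hm hmx hmv hv, hm hmu hmx hu, Icc_subset_uIcc'.trans hsub⟩

/-- The conditions involve only components (through `uIcc x y ⊆ Z`), relative neighbourhoods and the
interior, and mutually inverse continuous maps respect all three. -/
theorem RankedAt.image {Z Y : Set ℝ} {f g : ℝ → ℝ} {ρ : ℝ → Ordinal.{0}} {x : ℝ}
    (h : RankedAt Z ρ x) (hx : x ∈ Z) (hf : ContinuousOn f Z) (hg : ContinuousOn g Y)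
    (hfY : MapsTo f Z Y) (hgZ : MapsTo g Y Z) (hgf : LeftInvOn g f Z) (hfg : RightInvOn g f Y) :
    RankedAt Y (ρ ∘ g) (f x) := by
  have htf : Filter.Tendsto f (𝓝[Z] x) (𝓝[Y] (f x)) := (hf x hx).tendsto_nhdsWithin hfY
  have htg : Filter.Tendsto g (𝓝[Y] (f x)) (𝓝[Z] x) := by
    have := (hg (f x) (hfY hx)).tendsto_nhdsWithin hgZ
    rwa [hgf hx] at this
  have key : ∀ y, uIcc (f x) y ⊆ Y → uIcc x (g y) ⊆ Z := by
    intro y hy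
    have := uIcc_subset_of_continuousOn hg hgZ hy
    rwa [hgf hx] at this
  refine ⟨?_, ?_, ?_, ?_⟩
  · obtain ⟨y, hne, hy⟩ := h.exists_ne
    exact ⟨f y, fun e => hne (hgf.injOn (hy right_mem_uIcc) hx e),
      uIcc_subset_of_continuousOn hf hfY hy⟩
  · intro y hy
    simpa [hgf hx] using h.const _ (key y hy)
  · filter_upwards [htg.eventually h.lt_near, self_mem_nhdsWithin] with y h1 h2
    refine h1.imp (fun h3 => ?_) (fun h3 => by simpa [hgf hx] using h3)
    have := uIcc_subset_of_continuousOn hf hfY h3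
    rwa [hfg h2] at this
  · intro hxi δ hδ
    have hxi' : x ∉ interior Z := fun h1 =>
      hxi (mem_interior_of_continuousOn_injOn hf hfY hgf.injOn h1)
    refine htf.frequently (((h.approx hxi' δ (by simpa [hgf hx] using hδ)).and_eventually
      self_mem_nhdsWithin).mono ?_)
    rintro y ⟨⟨h1, h2⟩, h3⟩
    refine ⟨fun h4 => h1 ?_, by simpa [hgf h3] using h2⟩
    have := key _ h4
    rwa [hgf h3] at this

theorem IsRanking.image {Z Y : Set ℝ} {f g : ℝ → ℝ} {ρ : ℝ → Ordinal.{0}}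
    (h : IsRanking Z ρ) (hf : ContinuousOn f Z) (hg : ContinuousOn g Y)
    (hfY : MapsTo f Z Y) (hgZ : MapsTo g Y Z) (hgf : LeftInvOn g f Z) (hfg : RightInvOn g f Y) :
    IsRanking Y (ρ ∘ g) := by
  have hY : f '' Z = Y :=
    hfY.image_subset.antisymm fun y hy => ⟨g y, hgZ hy, hfg hy⟩
  refine ⟨hY ▸ h.isCompact.image_of_continuousOn hf, fun y hy => ?_⟩
  have := (h.rankedAt _ (hgZ hy)).image (hgZ hy) hf hg hfY hgZ hgf hfg
  rwa [hfg hy] at this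

theorem HasRank.image {Z Y : Set ℝ} {f g : ℝ → ℝ} {α : Ordinal.{0}}
    (h : HasRank Z α) (hf : ContinuousOn f Z) (hg : ContinuousOn g Y)
    (hfY : MapsTo f Z Y) (hgZ : MapsTo g Y Z) (hgf : LeftInvOn g f Z) (hfg : RightInvOn g f Y) :
    HasRank Y α := by
  obtain ⟨ρ, hρ, x, hx, hxα, hlt⟩ := h
  refine ⟨ρ ∘ g, hρ.image hf hg hfY hgZ hgf hfg, f x, hfY hx, by simp [hgf hx, hxα], ?_⟩
  intro y hy
  refine (hlt (g y) (hgZ hy)).imp_left fun h1 => ?_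
  have := uIcc_subset_of_continuousOn hf hfY h1
  rwa [hfg hy] at this

theorem HasRank.of_homeomorph {Z Y : Set ℝ} {α : Ordinal.{0}} (h : HasRank Z α) (e : Z ≃ₜ Y) :
    HasRank Y α := by
  classical
  -- The value `0` off the set is arbitrary; only continuity on the set is used.
  let f : ℝ → ℝ := fun x => if hx : x ∈ Z then e ⟨x, hx⟩ else 0
  let g : ℝ → ℝ := fun y => if hy : y ∈ Y then e.symm ⟨y, hy⟩ else 0
  have hf : ∀ x (hx : x ∈ Z), f x = e ⟨x, hx⟩ := fun x hx => dif_pos hx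
  have hg : ∀ y (hy : y ∈ Y), g y = e.symm ⟨y, hy⟩ := fun y hy => dif_pos hy
  refine h.image (f := f) (g := g) ?_ ?_ ?_ ?_ ?_ ?_
  · rw [continuousOn_iff_continuous_domRestrict]
    exact (continuous_subtype_val.comp e.continuous).congr fun x => (hf x x.2).symm
  · rw [continuousOn_iff_continuous_domRestrict]
    exact (continuous_subtype_val.comp e.symm.continuous).congr fun x => (hg x x.2).symm
  · intro x hx
    rw [hf x hx]
    exact Subtype.coe_prop _
  · intro y hy
    rw [hg y hy]
    exact Subtype.coe_prop _
  · intro x hx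
    rw [hf x hx, hg _ (Subtype.coe_prop _)]
    simp
  · intro y hy
    rw [hg y hy, hf _ (Subtype.coe_prop _)]
    simp

theorem HasRank.image_homeomorph {Z : Set ℝ} {α : Ordinal.{0}} (h : HasRank Z α) (e : ℝ ≃ₜ ℝ) :
    HasRank (e '' Z) α :=
  h.of_homeomorph (e.image Z)

theorem HasRank.neg {Z : Set ℝ} {α : Ordinal.{0}} (h : HasRank Z α) :
    HasRank (Neg.neg ⁻¹' Z) α := by
  have := h.image_homeomorph (Homeomorph.neg ℝ)
  rwa [Homeomorph.image_eq_preimage_symm] at this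

/-! ### Ends of components and cutting off pieces of prescribed rank. -/

/-- The end is the infimum of the points beyond `x` missing from `Z`. Ends are described by gaps
arbitrarily close to them, since these gaps later serve as cuts. -/
theorem exists_right_end {Z : Set ℝ} (hZ : IsCompact Z) {x : ℝ} (hx : x ∈ Z) :
    ∃ d, x ≤ d ∧ Icc x d ⊆ Z ∧ ∀ u > d, ∃ t ∈ Ioo d u, t ∉ Z := by
  set U := Ioi x \ Z with hU
  have hbb : BddBelow U := ⟨x, fun y hy => (show x < y from hy.1).le⟩
  obtain ⟨M, hM⟩ := hZ.bddAbove
  have hne : U.Nonempty :=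
    ⟨M + 1, by have := hM hx; simp only [mem_Ioi]; linarith,
      fun h => by have := hM h; linarith⟩
  have hxd : x ≤ sInf U := le_csInf hne fun y hy => (show x < y from hy.1).le
  have hlt : ∀ y, x ≤ y → y < sInf U → y ∈ Z := by
    intro y hy hyd
    rcases hy.eq_or_lt with rfl | hy
    · exact hx
    by_contra h
    exact notMem_of_lt_csInf hyd hbb ⟨hy, h⟩
  have hdZ : sInf U ∈ Z := by
    rcases hxd.eq_or_lt with h | h
    · rwa [← h]
    have h1 : Icc x (sInf U) ⊆ closure Z := by
      rw [← closure_Ico h.ne]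
      exact closure_mono fun y hy => hlt y hy.1 hy.2
    have h2 := h1 ⟨hxd, le_rfl⟩
    rwa [hZ.isClosed.closure_eq] at h2
  refine ⟨sInf U, hxd, ?_, ?_⟩
  · intro y hy
    rcases hy.2.eq_or_lt with h | h
    · rwa [h]
    · exact hlt y hy.1 h
  · intro u hu
    obtain ⟨t, ht, htu⟩ := exists_lt_of_csInf_lt hne hu
    exact ⟨t, ⟨lt_of_le_of_ne (csInf_le hbb ht) fun e => ht.2 (e ▸ hdZ), htu⟩, ht.2⟩

theorem exists_left_end {Z : Set ℝ} (hZ : IsCompact Z) {x : ℝ} (hx : x ∈ Z) :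
    ∃ d, d ≤ x ∧ Icc d x ⊆ Z ∧ ∀ u < d, ∃ t ∈ Ioo u d, t ∉ Z := by
  obtain ⟨d, h1, h2, h3⟩ := exists_right_end (Z := -Z) (x := -x) hZ.neg (by simpa using hx)
  refine ⟨-d, by linarith, ?_, ?_⟩
  · intro y hy
    have := h2 (show -y ∈ Icc (-x) d from ⟨by linarith [hy.2], by linarith [hy.1]⟩)
    simpa using this
  · intro u hu
    obtain ⟨t, ht, htZ⟩ := h3 (-u) (by linarith)
    exact ⟨-t, ⟨by linarith [ht.2], by linarith [ht.1]⟩, by simpa using htZ⟩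

theorem RankedAt.exists_Icc_right {Z : Set ℝ} {ρ : ℝ → Ordinal.{0}} {a : ℝ}
    (h : RankedAt Z ρ a) (ha : ∀ u < a, ∃ t ∈ Ioo u a, t ∉ Z) : ∃ v > a, Icc a v ⊆ Z := by
  obtain ⟨y, hne, hy⟩ := h.exists_ne
  rcases lt_or_gt_of_ne hne with h1 | h1
  · obtain ⟨t, ht, htZ⟩ := ha y h1
    exact absurd (hy (mem_uIcc.2 (Or.inr ⟨ht.1.le, ht.2.le⟩))) htZ
  · exact ⟨y, h1, Icc_subset_uIcc.trans hy⟩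

theorem notMem_interior_of_left_end {Z : Set ℝ} {a : ℝ} (ha : ∀ u < a, ∃ t ∈ Ioo u a, t ∉ Z) :
    a ∉ interior Z := by
  rw [mem_interior_iff_exists_Icc]
  rintro ⟨u, v, hu, hv, h⟩
  obtain ⟨t, ht, htZ⟩ := ha u hu
  exact htZ (h ⟨ht.1.le, ht.2.le.trans hv.le⟩)

/-- Near the left end point `a` of a component there are, to the left of `a`, components whose
rank is at least any given value below the rank of `a`. -/
theorem RankedAt.exists_lt_left {Z : Set ℝ} {ρ : ℝ → Ordinal.{0}} {a s : ℝ} {γ : Ordinal.{0}}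
    (h : RankedAt Z ρ a) (ha : ∀ u < a, ∃ t ∈ Ioo u a, t ∉ Z) (hs : s < a) (hγ : γ < ρ a) :
    ∃ y ∈ Z, s < y ∧ y < a ∧ γ ≤ ρ y := by
  obtain ⟨v, hv, hav⟩ := h.exists_Icc_right ha
  have hev : ∀ᶠ y in 𝓝[Z] a, y ∈ Ioo s v ∧ y ∈ Z :=
    Filter.Eventually.and (mem_nhdsWithin_of_mem_nhds (Ioo_mem_nhds hs hv)) self_mem_nhdsWithin
  obtain ⟨y, ⟨hy1, hy2⟩, hy3, hy4⟩ :=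
    ((h.approx (notMem_interior_of_left_end ha) γ hγ).and_eventually hev).exists
  refine ⟨y, hy4, hy3.1, ?_, hy2⟩
  by_contra! hay
  exact hy1 (by rw [uIcc_of_le hay]; exact (Icc_subset_Icc_right hy3.2.le).trans hav)

/-- To the left of an end point `a` of rank greater than `γ`, after any cut `s` one can cut off a
piece of rank `γ`. -/
theorem IsRanking.exists_cut {Z : Set ℝ} {ρ : ℝ → Ordinal.{0}} {a s : ℝ} {γ : Ordinal.{0}}
    (h : IsRanking Z ρ) (haZ : a ∈ Z) (ha : ∀ u < a, ∃ t ∈ Ioo u a, t ∉ Z) (hsZ : s ∉ Z)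
    (hs : s < a) (hγ : γ < ρ a) :
    ∃ t ∈ Ioo s a, t ∉ Z ∧ (∃ x ∈ Z ∩ Ioo s t, ρ x = γ) ∧ HasRank (Z ∩ Ioo s t) γ := by
  set A := {y | y ∈ Z ∧ s < y ∧ y < a ∧ γ ≤ ρ y} with hA
  have hAne : A.Nonempty := (h.rankedAt a haZ).exists_lt_left ha hs hγ
  have hbb : BddBelow A := ⟨s, fun y hy => hy.2.1.le⟩
  -- The first point after `s` of rank at least `γ`. It turns out to be the left end of a component
  -- of rank exactly `γ`, and the cut is made just behind that component.
  set m := sInf A with hm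
  have hmcl : m ∈ closure A := csInf_mem_closure hAne hbb
  have hmZ : m ∈ Z := h.isCompact.isClosed.closure_subset_iff.2 (fun y hy => hy.1) hmcl
  have hsm : s < m :=
    lt_of_le_of_ne (le_csInf hAne fun y hy => hy.2.1.le) fun e => hsZ (e ▸ hmZ)
  have hma : m < a := by
    obtain ⟨y, hy⟩ := hAne
    exact (csInf_le hbb hy).trans_lt hy.2.2.1
  have hml : ∀ y ∈ Z, s < y → y < m → ρ y < γ := by
    intro y hy h1 h2
    by_contra! h3
    exact notMem_of_lt_csInf h2 hbb ⟨hy, h1, h2.trans hma, h3⟩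
  -- Points of `A` accumulate at `m`; those near `m` lie in its component or have smaller rank than
  -- `m`.
  have hmγ : γ ≤ ρ m := by
    have hfr : ∃ᶠ y in 𝓝[Z] m, y ∈ A := by
      have h1 : ∃ᶠ y in 𝓝 m, y ∈ A := mem_closure_iff_frequently.1 hmcl
      rw [nhdsWithin, Filter.frequently_inf_principal]
      exact h1.mono fun y hy => ⟨hy.1, hy⟩
    obtain ⟨y, hyA, hy⟩ := (hfr.and_eventually (h.rankedAt m hmZ).lt_near).exists
    rcases hy with hy | hy
    · rw [← (h.rankedAt m hmZ).const y hy]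
      exact hyA.2.2.2
    · exact hyA.2.2.2.trans hy.le
  -- Otherwise the component of `m` would contain points between `s` and `m`, whose rank is both
  -- below `γ` and equal to `ρ m`.
  have hmleft : ∀ u < m, ∃ t ∈ Ioo u m, t ∉ Z := by
    intro u hu
    by_contra! hcon
    obtain ⟨y, hy1, hy2⟩ := exists_between (max_lt hu hsm)
    have hy3 := (max_lt_iff.1 hy1)
    have hsub : uIcc m y ⊆ Z := by
      rw [uIcc_of_ge hy2.le]
      intro z hz
      rcases hz.2.eq_or_lt with h1 | h1
      · rwa [h1]
      · exact hcon z ⟨hy3.1.trans_le hz.1, h1⟩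
    have h1 := hml y (hsub right_mem_uIcc) hy3.2 hy2
    rw [(h.rankedAt m hmZ).const y hsub] at h1
    exact absurd hmγ h1.not_ge
  -- A larger rank at `m` would force points of rank at least `γ` between `s` and `m`.
  have hmeq : ρ m = γ := by
    refine hmγ.antisymm' ?_
    by_contra! hlt
    obtain ⟨y, hy1, hy2, hy3, hy4⟩ := (h.rankedAt m hmZ).exists_lt_left hmleft hsm hlt
    exact absurd hy4 (hml y hy1 hy2 hy3).not_ge
  obtain ⟨d, hmd, hmdZ, hd⟩ := exists_right_end h.isCompact hmZ
  have hdZ : d ∈ Z := hmdZ ⟨hmd, le_rfl⟩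
  have hdeq : ρ d = γ := by
    rw [← hmeq]
    exact (h.rankedAt m hmZ).const d (by rwa [uIcc_of_le hmd])
  have hda : d < a := by
    by_contra! had
    obtain ⟨t, ht, htZ⟩ := ha m hma
    exact htZ (hmdZ ⟨ht.1.le, ht.2.le.trans had⟩)
  have hev := (h.rankedAt d hdZ).lt_near
  rw [nhdsWithin, Filter.eventually_inf_principal, Metric.eventually_nhds_iff] at hev
  obtain ⟨ε, hε, hev⟩ := hev
  -- The cut is so close to `d` that every other component between `d` and `t` has rank below `γ`.
  obtain ⟨t, ht, htZ⟩ := hd (min a (d + ε)) (lt_min hda (by linarith))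
  have hta := lt_min_iff.1 ht.2
  have hmt : m ∈ Z ∩ Ioo s t := ⟨hmZ, hsm, hmd.trans_lt ht.1⟩
  refine ⟨t, ⟨hmt.2.1.trans hmt.2.2, hta.1⟩, htZ, ⟨m, hmt, hmeq⟩, ρ, h.inter_Ioo hsZ htZ, m, hmt,
    hmeq, ?_⟩
  rintro y ⟨hyZ, hy⟩
  rcases lt_or_ge y m with h1 | h1
  · exact Or.inr (hml y hyZ hy.1 h1)
  have hloc : uIcc m y ⊆ Z → uIcc m y ⊆ Z ∩ Ioo s t := fun h2 =>
    subset_inter h2 (ordConnected_Ioo.uIcc_subset hmt.2 hy)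
  rcases le_or_gt y d with h2 | h2
  · exact Or.inl (hloc (by rw [uIcc_of_le h1]; exact (Icc_subset_Icc_right h2).trans hmdZ))
  · have h3 : dist y d < ε := by
      rw [Real.dist_eq, abs_of_pos (by linarith)]
      linarith [hy.2]
    refine (hev h3 hyZ).imp (fun h4 => hloc ?_) (fun h4 => by rwa [hdeq] at h4)
    rw [uIcc_of_le h1, ← Icc_union_Icc_eq_Icc hmd h2.le]
    exact union_subset hmdZ (by rwa [uIcc_of_le h2.le] at h4)

/-- The part of `Z` to the left of an end point `a` of locally largest rank is an `ω`-sequence of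
pieces of prescribed ranks. -/
theorem IsRanking.exists_cuts {Z : Set ℝ} {ρ : ℝ → Ordinal.{0}} {a : ℝ} (h : IsRanking Z ρ)
    (haZ : a ∈ Z) (ha : ∀ u < a, ∃ t ∈ Ioo u a, t ∉ Z) (hlt : ∀ y ∈ Z, y < a → ρ y < ρ a)
    {γ : ℕ → Ordinal.{0}} (hmono : Monotone γ) (hγ : ∀ i, γ i < ρ a)
    (hcof : ∀ δ < ρ a, ∃ i, δ ≤ γ i) :
    ∃ s : ℕ → ℝ, StrictMono s ∧ (∀ i, s i < a) ∧ (∀ i, s i ∉ Z) ∧ (∀ y ∈ Z, s 0 < y) ∧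
      (∀ i, HasRank (Z ∩ Ioo (s i) (s (i + 1))) (γ i)) ∧ ∀ y < a, ∃ i, y < s i := by
  obtain ⟨M, hM⟩ := h.isCompact.bddBelow
  have step : ∀ (i : ℕ) (s : {s : ℝ // s < a ∧ s ∉ Z}), ∃ t : {s : ℝ // s < a ∧ s ∉ Z},
      (s : ℝ) < t ∧ (∃ x ∈ Z ∩ Ioo (s : ℝ) t, ρ x = γ i) ∧ HasRank (Z ∩ Ioo (s : ℝ) t) (γ i) := by
    intro i s
    obtain ⟨t, ht, htZ, h1, h2⟩ := h.exists_cut haZ ha s.2.2 s.2.1 (hγ i)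
    exact ⟨⟨t, ht.2, htZ⟩, ht.1, h1, h2⟩
  choose F hF1 hF2 hF3 using step
  have hM0 : ∀ y ∈ Z, M - 1 < y := fun y hy => by have := hM hy; linarith
  let s : ℕ → {s : ℝ // s < a ∧ s ∉ Z} := fun n =>
    Nat.rec ⟨M - 1, hM0 a haZ, fun hh => lt_irrefl _ (hM0 _ hh)⟩ F n
  have hs : StrictMono fun i : ℕ => (s i).1 := by
    refine strictMono_nat_of_lt_succ fun n => ?_
    exact hF1 n (s n)
  refine ⟨fun i => (s i).1, hs, fun i => (s i).2.1, fun i => (s i).2.2, hM0, fun i => hF3 i (s i), ?_⟩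
  have hbdd : BddAbove (range fun i => (s i).1) :=
    ⟨a, by rintro _ ⟨i, rfl⟩; exact (s i).2.1.le⟩
  -- The cuts must converge to `a`. If their limit `L` were smaller, the points `x i` of rank `γ i`
  -- would converge to `L ∈ Z`, and eventually `γ i ≥ ρ L`, contrary to `lt_near` at `L`.
  have htend := tendsto_atTop_ciSup hs.monotone hbdd
  set L := ⨆ i, (s i).1 with hL
  by_cases hLa : L < a
  swap
  · intro y hy
    exact exists_lt_of_lt_ciSup (hy.trans_le (not_lt.1 hLa))
  exfalso
  choose x hx hxγ using fun i => hF2 i (s i)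
  have hxs : ∀ i, x i < s (i + 1) := fun i => (hx i).2.2
  have hxL : Filter.Tendsto x Filter.atTop (𝓝 L) :=
    tendsto_of_tendsto_of_tendsto_of_le_of_le htend (htend.comp (Filter.tendsto_add_atTop_nat 1))
      (fun i => (hx i).2.1.le) (fun i => (hxs i).le)
  have hLZ : L ∈ Z :=
    h.isCompact.isClosed.mem_of_tendsto hxL (Filter.Eventually.of_forall fun i => (hx i).1)
  obtain ⟨i₀, hi₀⟩ := hcof _ (hlt L hLZ hLa)
  have hxL' : Filter.Tendsto x Filter.atTop (𝓝[Z] L) :=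
    tendsto_nhdsWithin_iff.2 ⟨hxL, Filter.Eventually.of_forall fun i => (hx i).1⟩
  obtain ⟨i, hi, hii⟩ :=
    ((hxL'.eventually (h.rankedAt L hLZ).lt_near).and (Filter.eventually_ge_atTop i₀)).exists
  rcases hi with hi | hi
  -- The cut `s (i + 1)` separates `x i` from `L`, so they are in different components.
  · refine (s (i + 1)).2.2 (hi (mem_uIcc.2 (Or.inr ⟨(hxs i).le, ?_⟩)))
    exact le_ciSup hbdd (i + 1)
  · rw [hxγ] at hi
    exact absurd (hi₀.trans (hmono hii)) hi.not_ge

/-! ### From cuts to two-sided sums. -/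

theorem strictMono_sumLex_elim {α β γ : Type*} [Preorder α] [Preorder β] [Preorder γ] {f : α → γ}
    {g : β → γ} (hf : StrictMono f) (hg : StrictMono g) (h : ∀ a b, f a < g b) :
    StrictMono fun x : α ⊕ₗ β => Sum.elim f g (ofLex x) := by
  intro x y hxy
  change toLex (ofLex x) < toLex (ofLex y) at hxy
  rcases hx : ofLex x with a | a <;> rcases hy : ofLex y with b | b <;> rw [hx, hy] at hxy
  · simpa [hx, hy] using hf (Sum.Lex.inl_lt_inl_iff.1 hxy)
  · simpa [hx, hy] using h a b
  · exact absurd hxy Sum.Lex.not_inr_lt_inl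
  · simpa [hx, hy] using hg (Sum.Lex.inr_lt_inr_iff.1 hxy)

theorem strictMono_sigmaLex {ι γ : Type*} {α : ι → Type*} [Preorder ι] [∀ i, Preorder (α i)]
    [Preorder γ] {f : ∀ i, α i → γ} (hf : ∀ i, StrictMono (f i))
    (h : ∀ i j, i < j → ∀ x y, f i x < f j y) :
    StrictMono fun x : Σₗ i, α i => f (ofLex x).1 (ofLex x).2 := by
  intro x y hxy
  obtain ⟨i, x⟩ := x
  obtain ⟨j, y⟩ := y
  rcases Sigma.lex_iff.1 (show Sigma.Lex _ _ _ _ from hxy) with h1 | ⟨h1, h2⟩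
  · exact h _ _ h1 _ _
  · obtain rfl : i = j := h1
    exact hf i h2

theorem exists_mem_Ioo_succ {Z : Set ℝ} {s : ℕ → ℝ} (hs : ∀ i, s i ∉ Z) {y : ℝ} (hy : y ∈ Z)
    (h0 : s 0 < y) (h : ∃ i, y < s i) : ∃ i, y ∈ Ioo (s i) (s (i + 1)) := by
  classical
  obtain ⟨k, hk⟩ : ∃ k, Nat.find h = k + 1 :=
    Nat.exists_eq_succ_of_ne_zero fun e => by
      have := Nat.find_spec h
      rw [e] at this
      exact lt_asymm h0 this
  refine ⟨k, ?_, hk ▸ Nat.find_spec h⟩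
  have := Nat.find_min h (m := k) (by omega)
  exact lt_of_le_of_ne (not_lt.1 this) fun e => hs k (e ▸ hy)

/-- A set of reals that is cut into two sequences of pieces around a segment is a two-sided sum. -/
theorem nonempty_orderIso_twoSidedSum {Z : Set ℝ} {a b : ℝ} {s t : ℕ → ℝ} {L : ℕ → LinOrd.{0}}
    (hab : a < b) (hZ : Icc a b ⊆ Z)
    (hs : StrictMono s) (hsa : ∀ i, s i < a) (hsZ : ∀ i, s i ∉ Z) (hs0 : ∀ y ∈ Z, s 0 < y)
    (hsc : ∀ y < a, ∃ i, y < s i)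
    (ht : StrictAnti t) (htb : ∀ i, b < t i) (htZ : ∀ i, t i ∉ Z) (ht0 : ∀ y ∈ Z, y < t 0)
    (htc : ∀ y > b, ∃ i, t i < y)
    (e : ∀ i, Nonempty ((Z ∩ Ioo (s i) (s (i + 1)) : Set ℝ) ≃o L i))
    (e' : ∀ i, Nonempty ((Z ∩ Ioo (t (i + 1)) (t i) : Set ℝ) ≃o L i)) :
    Nonempty (Z ≃o twoSidedSum L) := by
  replace e := fun i => (e i).some
  replace e' := fun i => (e' i).some
  let f₁ : (Σₗ n : ℕ, L n) → ℝ := fun x => (e (ofLex x).1).symm (ofLex x).2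
  let f₂ : Icc (0 : ℝ) 1 → ℝ := fun x => a + (b - a) * x
  let f₃ : (Σₗ n : ℕᵒᵈ, L (OrderDual.ofDual n)) → ℝ :=
    fun x => (e' (OrderDual.ofDual (ofLex x).1)).symm (ofLex x).2
  have hf₁ : StrictMono f₁ := by
    refine strictMono_sigmaLex (f := fun i x => ((e i).symm x : ℝ))
      (fun i => fun x y hxy => (e i).symm.strictMono hxy) fun i j hij x y => ?_
    exact (((e i).symm x).2.2.2.trans_le (hs.monotone hij)).trans ((e j).symm y).2.2.1
  have hf₃ : StrictMono f₃ := by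
    refine strictMono_sigmaLex (ι := ℕᵒᵈ)
      (f := fun i x => ((e' (OrderDual.ofDual i)).symm x : ℝ))
      (fun i => fun x y hxy => (e' (OrderDual.ofDual i)).symm.strictMono hxy) fun i j hij x y => ?_
    exact (((e' (OrderDual.ofDual i)).symm x).2.2.2.trans_le
      (ht.antitone (show OrderDual.ofDual j + 1 ≤ OrderDual.ofDual i from hij))).trans
      ((e' (OrderDual.ofDual j)).symm y).2.2.1
  have hf₂ : StrictMono f₂ := by
    intro x y hxy
    have h1 : (x : ℝ) < y := hxy
    have : (b - a) * x < (b - a) * y := mul_lt_mul_of_pos_left h1 (by linarith)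
    simp only [f₂]
    linarith
  have hr₁ : ∀ x, f₁ x ∈ Z ∧ f₁ x < a := fun x =>
    ⟨((e _).symm _).2.1, ((e _).symm _).2.2.2.trans (hsa _)⟩
  have hr₂ : ∀ x, f₂ x ∈ Icc a b := by
    rintro ⟨x, hx0, hx1⟩
    have h1 : 0 ≤ (b - a) * x := mul_nonneg (by linarith) hx0
    have h2 : (b - a) * x ≤ (b - a) * 1 := mul_le_mul_of_nonneg_left hx1 (by linarith)
    constructor <;> simp only [f₂] <;> linarith
  have hr₃ : ∀ x, f₃ x ∈ Z ∧ b < f₃ x := fun x =>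
    ⟨((e' _).symm _).2.1, (htb _).trans ((e' _).symm _).2.2.1⟩
  let f : twoSidedSum L → ℝ := fun x =>
    Sum.elim f₁ (fun y => Sum.elim f₂ f₃ (ofLex y))
      (ofLex (show (Σₗ n : ℕ, L n) ⊕ₗ (Icc (0 : ℝ) 1 ⊕ₗ (Σₗ n : ℕᵒᵈ, L (OrderDual.ofDual n))) from x))
  have hf : StrictMono f := by
    refine strictMono_sumLex_elim hf₁ (strictMono_sumLex_elim hf₂ hf₃
      fun x y => (hr₂ x).2.trans_lt (hr₃ y).2) fun x y => (hr₁ x).2.trans_le ?_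
    rcases hy : ofLex y with z | z
    · exact (hr₂ z).1
    · exact (hab.trans (hr₃ z).2).le
  have hrange : range f = Z := by
    apply Subset.antisymm
    · rintro _ ⟨x, rfl⟩
      change Sum.elim f₁ (fun y => Sum.elim f₂ f₃ (ofLex y)) _ ∈ Z
      rcases (show _ ⊕ _ from x) with z | z
      · exact (hr₁ z).1
      · rcases z with z | z
        · exact hZ (hr₂ z)
        · exact (hr₃ z).1
    · intro y hy
      rcases lt_or_ge y a with hya | hya
      · obtain ⟨i, hi⟩ := exists_mem_Ioo_succ hsZ hy (hs0 y hy) (hsc y hya)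
        refine ⟨Sum.inl ⟨i, e i ⟨y, hy, hi⟩⟩, ?_⟩
        change ((e i).symm (e i ⟨y, hy, hi⟩) : ℝ) = y
        simp
      rcases le_or_gt y b with hyb | hyb
      · have hba : 0 < b - a := by linarith
        refine ⟨Sum.inr (Sum.inl ⟨(y - a) / (b - a), by apply div_nonneg <;> linarith,
          by rw [div_le_one hba]; linarith⟩), ?_⟩
        change a + (b - a) * ((y - a) / (b - a)) = y
        field_simp
        ring
      -- Reflection turns the decreasing cuts on the right into increasing ones.
      · obtain ⟨i, hi⟩ := exists_mem_Ioo_succ (Z := -Z) (s := fun i => -t i) (y := -y)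
          (fun i => by simpa using htZ i) (by simpa using hy) (neg_lt_neg (ht0 y hy))
          ((htc y hyb).imp fun i hi => neg_lt_neg hi)
        have hi' : y ∈ Ioo (t (i + 1)) (t i) := ⟨neg_lt_neg_iff.1 hi.2, neg_lt_neg_iff.1 hi.1⟩
        refine ⟨Sum.inr (Sum.inr ⟨OrderDual.toDual i, e' i ⟨y, hy, hi'⟩⟩), ?_⟩
        change ((e' i).symm (e' i ⟨y, hy, hi'⟩) : ℝ) = y
        simp
  exact ⟨((OrderIso.setCongr _ _ hrange.symm).trans (hf.orderIso f).symm)⟩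

theorem IsRanking.neg {Z : Set ℝ} {ρ : ℝ → Ordinal.{0}} (h : IsRanking Z ρ) :
    IsRanking (Neg.neg ⁻¹' Z) (ρ ∘ Neg.neg) :=
  h.image (f := Neg.neg) continuous_neg.continuousOn continuous_neg.continuousOn
    (fun x hx => by simpa using hx) (fun x hx => hx) (fun x _ => neg_neg x) (fun x _ => neg_neg x)

/-- The component of maximal rank as a segment. -/
theorem HasRank.exists_center {Z : Set ℝ} {α : Ordinal.{0}} (h : HasRank Z α) :
    ∃ ρ a b, IsRanking Z ρ ∧ a < b ∧ Icc a b ⊆ Z ∧ ρ a = α ∧ ρ b = α ∧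
      (∀ u < a, ∃ t ∈ Ioo u a, t ∉ Z) ∧ (∀ u > b, ∃ t ∈ Ioo b u, t ∉ Z) ∧
      ∀ y ∈ Z, y ∉ Icc a b → ρ y < α := by
  obtain ⟨ρ, hρ, x, hx, hxα, hlt⟩ := h
  obtain ⟨a, hax, haZ, ha⟩ := exists_left_end hρ.isCompact hx
  obtain ⟨b, hxb, hbZ, hb⟩ := exists_right_end hρ.isCompact hx
  have hsub : Icc a b ⊆ Z := by
    rw [← Icc_union_Icc_eq_Icc hax hxb]
    exact union_subset haZ hbZ
  have hout : ∀ y, uIcc x y ⊆ Z → y ∈ Icc a b := by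
    intro y hy
    constructor
    · by_contra! h1
      obtain ⟨t, ht, htZ⟩ := ha y h1
      exact htZ (hy (mem_uIcc.2 (Or.inr ⟨ht.1.le, ht.2.le.trans hax⟩)))
    · by_contra! h1
      obtain ⟨t, ht, htZ⟩ := hb y h1
      exact htZ (hy (mem_uIcc.2 (Or.inl ⟨hxb.trans ht.1.le, ht.2.le⟩)))
  refine ⟨ρ, a, b, hρ, ?_, hsub, ?_, ?_, ha, hb, ?_⟩
  · obtain ⟨y, hne, hy⟩ := (hρ.rankedAt x hx).exists_ne
    have := hout y hy
    refine lt_of_le_of_ne (hax.trans hxb) fun e => hne ?_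
    subst e
    exact (le_antisymm this.2 this.1).trans (le_antisymm hax hxb)
  · rw [← hxα]
    exact (hρ.rankedAt x hx).const a (by rwa [uIcc_of_ge hax])
  · rw [← hxα]
    exact (hρ.rankedAt x hx).const b (by rwa [uIcc_of_le hxb])
  · intro y hy hyab
    exact (hlt y hy).resolve_left fun h1 => hyab (hout y h1)

/-- The right side of the central component is cut by applying `IsRanking.exists_cuts` to the
reflected set; the pieces obtained there are reflected back, which does not affect their rank. -/
theorem HasRank.nonempty_orderIso_twoSidedSum {Z : Set ℝ} {α : Ordinal.{0}} (h : HasRank Z α)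
    {γ : ℕ → Ordinal.{0}} (hmono : Monotone γ) (hγ : ∀ i, γ i < α)
    (hcof : ∀ δ < α, ∃ i, δ ≤ γ i) {L : ℕ → LinOrd.{0}}
    (hL : ∀ i (W : Set ℝ), HasRank W (γ i) → Nonempty (W ≃o L i)) :
    Nonempty (Z ≃o twoSidedSum L) := by
  obtain ⟨ρ, a, b, hρ, hab, hsub, haα, hbα, ha, hb, hlt⟩ := h.exists_center
  have haZ : a ∈ Z := hsub ⟨le_rfl, hab.le⟩
  have hbZ : b ∈ Z := hsub ⟨hab.le, le_rfl⟩
  obtain ⟨s, hs, hsa, hsZ, hs0, hsr, hsc⟩ := hρ.exists_cuts haZ ha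
    (fun y hy hya => by rw [haα]; exact hlt y hy fun h => absurd h.1 hya.not_ge)
    hmono (haα ▸ hγ) (haα ▸ hcof)
  obtain ⟨t, ht, htb, htZ, ht0, htr, htc⟩ := hρ.neg.exists_cuts (a := -b) (γ := γ)
    (by simpa using hbZ)
    (fun u hu => by
      obtain ⟨t, ht, htZ⟩ := hb (-u) (by linarith)
      exact ⟨-t, ⟨by linarith [ht.2], by linarith [ht.1]⟩, by simpa using htZ⟩)
    (fun y hy hya => by
      simp only [Function.comp, neg_neg, hbα]
      exact hlt (-y) hy fun h => absurd h.2 (by linarith))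
    hmono (by simpa [hbα] using hγ) (by simpa [hbα] using hcof)
  refine _root_.nonempty_orderIso_twoSidedSum (t := fun i => -t i) hab hsub hs hsa hsZ hs0 hsc
    (fun i j hij => neg_lt_neg (ht hij)) (fun i => by linarith [htb i]) htZ
    (fun y hy => by linarith [ht0 (-y) (by simpa using hy)])
    (fun y hy => ?_) (fun i => hL i _ (hsr i)) (fun i => hL i _ ?_)
  · obtain ⟨i, hi⟩ := htc (-y) (by linarith)
    exact ⟨i, by linarith⟩
  · convert (htr i).neg using 1
    ext y
    simp only [mem_inter_iff, mem_preimage, mem_Ioo, neg_neg]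
    constructor
    · rintro ⟨h1, h2, h3⟩
      exact ⟨h1, by linarith, by linarith⟩
    · rintro ⟨h1, h2, h3⟩
      exact ⟨h1, by linarith, by linarith⟩

theorem nonempty_Icc_orderIso {a b : ℝ} (hab : a < b) : Nonempty (Icc a b ≃o Icc (0 : ℝ) 1) := by
  have h : 0 < b - a := by linarith
  have hf : StrictMono fun x : ℝ => (x - a) / (b - a) := fun x y hxy =>
    div_lt_div_of_pos_right (by linarith) h
  have hr : (fun x : ℝ => (x - a) / (b - a)) '' Icc a b = Icc 0 1 := by
    ext y
    constructor
    · rintro ⟨x, hx, rfl⟩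
      exact ⟨div_nonneg (by linarith [hx.1]) h.le, by rw [div_le_one h]; linarith [hx.2]⟩
    · intro hy
      refine ⟨a + (b - a) * y, ⟨?_, ?_⟩, ?_⟩
      · nlinarith [hy.1]
      · nlinarith [hy.2]
      · field_simp
        ring
  exact ⟨((hf.strictMonoOn _).orderIso _ _).trans (OrderIso.setCongr _ _ hr)⟩

theorem HasRank.nonempty_orderIso_Icc {Z : Set ℝ} (h : HasRank Z 0) :
    Nonempty (Z ≃o Icc (0 : ℝ) 1) := by
  obtain ⟨ρ, a, b, hρ, hab, hsub, -, -, -, -, hlt⟩ := h.exists_center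
  obtain rfl : Icc a b = Z := by
    refine hsub.antisymm fun y hy => ?_
    by_contra h1
    exact (not_lt_zero (hlt y hy h1))
  exact nonempty_Icc_orderIso hab

/-! ### The rank determines the order type. -/

theorem iteratedS_zero (c : LimitSequences) : iteratedS c 0 = LinOrd.of (Icc (0 : ℝ) 1) :=
  Ordinal.limitRecOn_zero ..

theorem iteratedS_add_one (c : LimitSequences) (α : Ordinal.{0}) :
    iteratedS c (α + 1) = twoSidedSum fun _ => iteratedS c α :=
  Ordinal.limitRecOn_add_one ..

theorem iteratedS_limit (c : LimitSequences) {α : Ordinal.{0}} (hα : Order.IsSuccLimit α) :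
    iteratedS c α = twoSidedSum fun n => iteratedS c (c α hα n) :=
  Ordinal.limitRecOn_limit ..

/-- The prescribed ranks are those of the blocks in the recursion: constantly `γ` at `γ + 1`, the
chosen sequence at a limit. Countability of `α` is what makes the chosen sequences cofinal. -/
theorem HasRank.nonempty_orderIso_iteratedS {c : LimitSequences} (hc : c.IsFundamental)
    {α : Ordinal.{0}} (hα : α < Ordinal.omega 1) {Z : Set ℝ} (h : HasRank Z α) :
    Nonempty (Z ≃o iteratedS c α) := by
  induction α using Ordinal.limitRecOn generalizing Z with
  | zero =>
    rw [iteratedS_zero]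
    exact h.nonempty_orderIso_Icc
  | add_one γ ih =>
    rw [iteratedS_add_one]
    exact h.nonempty_orderIso_twoSidedSum (γ := fun _ => γ) monotone_const
      (fun _ => lt_add_one γ) (fun δ hδ => ⟨0, Order.lt_add_one_iff.1 hδ⟩)
      fun _ W hW => ih ((lt_add_one γ).trans hα) hW
  | limit α hlim ih =>
    rw [iteratedS_limit c hlim]
    obtain ⟨h1, h2⟩ := hc α hlim hα
    exact h.nonempty_orderIso_twoSidedSum (γ := fun n => (c α hlim n : Ordinal.{0}))
      (fun i j hij => h1.monotone hij) (fun n => (c α hlim n).2)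
      (fun δ hδ => (h2 δ hδ).imp fun _ => le_of_lt)
      fun n W hW => ih _ (c α hlim n).2 ((mem_Iio.1 (c α hlim n).2).trans hα) hW

/-! ### Existence of sets of every countable rank. -/

theorem HasRank.exists_subset_Ioo {Z : Set ℝ} {α : Ordinal.{0}} (h : HasRank Z α) {u v : ℝ}
    (huv : u < v) : ∃ W ⊆ Ioo u v, HasRank W α := by
  obtain ⟨M, hM0, hM⟩ := h.isCompact.isBounded.exists_pos_norm_le
  -- This factor maps `[-M, M]` onto the middle half of `(u, v)`, leaving room for strict
  -- inequalities.
  have hk : 0 < (v - u) / (4 * M) := div_pos (by linarith) (by linarith)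
  refine ⟨_, ?_, h.image_homeomorph (affineHomeomorph ((v - u) / (4 * M)) ((u + v) / 2) hk.ne')⟩
  rintro _ ⟨x, hx, rfl⟩
  have h1 := abs_le.1 (hM x hx)
  have h2 : (v - u) / (4 * M) * M = (v - u) / 4 := by
    field_simp
  have h3 := mul_le_mul_of_nonneg_left h1.1 hk.le
  have h4 := mul_le_mul_of_nonneg_left h1.2 hk.le
  simp only [affineHomeomorph_apply, mem_Ioo]
  constructor <;> linarith

theorem hasRank_zero : HasRank (Icc (0 : ℝ) 1) 0 := by
  have hsub : ∀ x ∈ Icc (0 : ℝ) 1, ∀ y ∈ Icc (0 : ℝ) 1, uIcc x y ⊆ Icc 0 1 := fun x hx y hy =>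
    ordConnected_Icc.uIcc_subset hx hy
  refine ⟨0, ⟨isCompact_Icc, fun x hx => ⟨?_, fun _ _ => rfl, ?_, ?_⟩⟩, 0, by simp, rfl,
    fun y hy => Or.inl (hsub _ (by simp) y hy)⟩
  · by_cases h : x = 0
    · exact ⟨1, by simp [h], hsub _ hx _ (by simp)⟩
    · exact ⟨0, fun e => h e.symm, hsub _ hx _ (by simp)⟩
  · filter_upwards [self_mem_nhdsWithin] with y hy using Or.inl (hsub x hx y hy)
  · exact fun _ δ hδ => absurd hδ not_lt_zero

/-- Pieces of cofinal smaller ranks, placed symmetrically around `[-1, 1]`, form a set of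
rank `α`. -/
theorem exists_hasRank_of_cofinal {α : Ordinal.{0}} {γ : ℕ → Ordinal.{0}} (hmono : Monotone γ)
    (hγ : ∀ i, γ i < α) (hcof : ∀ δ < α, ∃ i, δ ≤ γ i) (hex : ∀ i, ∃ Z, HasRank Z (γ i)) :
    ∃ Z, HasRank Z α := by
  classical
  -- Cut points decreasing to `1`; the piece of rank `γ n` goes strictly between `c (n + 1)` and `c
  -- n`, so no cut point meets any piece.
  let c : ℕ → ℝ := fun n => 1 + 1 / ((n : ℝ) + 1)
  have hc1 : ∀ n, 1 < c n := fun n => by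
    have : (0 : ℝ) < 1 / ((n : ℝ) + 1) := Nat.one_div_pos_of_nat
    simp only [c]
    linarith
  have hcanti : StrictAnti c := fun m n hmn =>
    (add_lt_add_iff_left 1).2 (Nat.one_div_lt_one_div hmn)
  have hctend : Filter.Tendsto c Filter.atTop (𝓝 1) := by
    have := (tendsto_one_div_add_atTop_nhds_zero_nat (𝕜 := ℝ)).const_add 1
    rwa [add_zero] at this
  have hcex : ∀ y > 1, ∃ N, c N < y := fun y hy => (hctend.eventually_lt_const hy).exists
  have hpl : ∀ n, ∃ W ⊆ Ioo (c (n + 1)) (c n), HasRank W (γ n) := fun n =>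
    (hex n).choose_spec.exists_subset_Ioo (hcanti n.lt_succ_self)
  choose Z hZI hZ using hpl
  choose r hr x hxZ hxγ hlt using hZ
  have hle : ∀ n, ∀ y ∈ Z n, r n y ≤ γ n := by
    intro n y hy
    rcases hlt n y hy with h | h
    · rw [((hr n).rankedAt _ (hxZ n)).const y h, hxγ]
    · exact h.le
  have hZ1 : ∀ {n y}, y ∈ Z n → 1 < y := fun {n y} hy => (hc1 _).trans (hZI n hy).1
  have hinj : ∀ {m n y}, y ∈ Z m → y ∈ Ioo (c (n + 1)) (c n) → m = n := by
    intro m n y hm hn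
    have hm := hZI m hm
    have h1 := hcanti.lt_iff_gt.1 (hm.1.trans hn.2)
    have h2 := hcanti.lt_iff_gt.1 (hn.1.trans hm.2)
    omega
  have hcZ : ∀ m n, c n ∉ Z m := by
    intro m n h
    have h0 := hZI m h
    have h1 := hcanti.lt_iff_gt.1 h0.1
    have h2 := hcanti.lt_iff_gt.1 h0.2
    omega
  -- Using `|y|` produces the pieces and their mirror images at once. The default value `α` of `ρ`
  -- is its value on the core `[-1, 1]`.
  let X : Set ℝ := {y | |y| ≤ 1 ∨ ∃ n, |y| ∈ Z n}
  let ρ : ℝ → Ordinal.{0} := fun y => if h : ∃ n, |y| ∈ Z n then r h.choose |y| else α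
  have hρ : ∀ n y, |y| ∈ Z n → ρ y = r n |y| := by
    intro n y hy
    have h : ∃ n, |y| ∈ Z n := ⟨n, hy⟩
    have : h.choose = n := hinj h.choose_spec (hZI n hy)
    simp only [ρ, dif_pos h, this]
  have hρα : ∀ y, |y| ≤ 1 → ρ y = α := fun y hy =>
    dif_neg fun ⟨n, hn⟩ => (hZ1 hn).not_ge hy
  have hρlt : ∀ y ∈ X, ¬ |y| ≤ 1 → ρ y < α := by
    rintro y (hy | ⟨n, hn⟩) h
    · exact absurd hy h
    · rw [hρ n y hn]
      exact (hle n _ hn).trans_lt (hγ n)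
  have hcX : ∀ y, (∃ n, |y| = c n) → y ∉ X := by
    rintro y ⟨n, hn⟩ (h | ⟨m, h⟩)
    · rw [hn] at h
      exact absurd (hc1 n) h.not_gt
    · rw [hn] at h
      exact hcZ m n h
  have hcX₁ : ∀ n, c n ∉ X := fun n => hcX _ ⟨n, abs_of_pos (one_pos.trans (hc1 n))⟩
  have hcX₂ : ∀ n, -c n ∉ X := fun n =>
    hcX _ ⟨n, by rw [abs_neg, abs_of_pos (one_pos.trans (hc1 n))]⟩
  have hcore : ∀ y, |y| ≤ 1 → ∀ z, |z| ≤ 1 → uIcc y z ⊆ X := by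
    intro y hy z hz
    have : uIcc y z ⊆ Icc (-1) 1 :=
      ordConnected_Icc.uIcc_subset (abs_le.1 hy) (abs_le.1 hz)
    exact fun w hw => Or.inl (abs_le.2 (this hw))
  -- The core is a whole component, because the points `c N` and `-c N` outside `X` come arbitrarily
  -- close to it.
  have hcore' : ∀ y, |y| ≤ 1 → ∀ z, uIcc y z ⊆ X → |z| ≤ 1 := by
    intro y hy z hz
    by_contra! h
    obtain ⟨N, hN⟩ := hcex _ h
    have h1 := abs_le.1 hy
    have h2 := hc1 N
    rcases lt_abs.1 hN with h3 | h3
    · exact hcX₁ N (hz (mem_uIcc.2 (Or.inl ⟨by linarith, h3.le⟩)))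
    · exact hcX₂ N (hz (mem_uIcc.2 (Or.inr ⟨by linarith, by linarith⟩)))
  have hclosed : IsClosed X := by
    refine isClosed_of_closure_subset fun y hy => ?_
    by_cases h1 : |y| ≤ 1
    · exact Or.inl h1
    -- Away from the core only finitely many pieces occur, and a finite union of closed sets is
    -- closed.
    obtain ⟨N, hN⟩ := hcex _ (not_le.1 h1)
    have hU : {z : ℝ | c N < |z|} ∈ 𝓝 y :=
      (isOpen_lt continuous_const continuous_abs).mem_nhds hN
    have hF : IsClosed (⋃ n ∈ Finset.range N, {z : ℝ | |z| ∈ Z n}) :=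
      isClosed_biUnion_finset fun n _ => (hr n).isCompact.isClosed.preimage continuous_abs
    have hy' : y ∈ closure (X ∩ {z : ℝ | c N < |z|}) := by
      rw [mem_closure_iff_frequently] at hy ⊢
      exact (hy.and_eventually hU).mono fun z hz => hz
    have hsub : X ∩ {z : ℝ | c N < |z|} ⊆ ⋃ n ∈ Finset.range N, {z : ℝ | |z| ∈ Z n} := by
      rintro z ⟨hz | ⟨n, hz⟩, hzN⟩
      · exact absurd (((hc1 N).trans hzN)) hz.not_gt
      · have := hcanti.lt_iff_gt.1 (lt_trans hzN (hZI n hz).2)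
        exact mem_biUnion (Finset.mem_coe.2 (Finset.mem_range.2 this)) hz
    have := hF.closure_subset_iff.2 hsub hy'
    obtain ⟨n, -, hn⟩ := mem_iUnion₂.1 this
    exact Or.inr ⟨n, hn⟩
  have hcompact : IsCompact X := by
    refine (isCompact_Icc (a := -c 0) (b := c 0)).of_isClosed_subset hclosed ?_
    rintro y (hy | ⟨n, hn⟩)
    · exact abs_le.1 (hy.trans (hc1 0).le)
    · exact abs_le.1 ((hZI n hn).2.le.trans (hcanti.antitone n.zero_le))
  have hxtend : Filter.Tendsto x Filter.atTop (𝓝 1) :=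
    tendsto_of_tendsto_of_tendsto_of_le_of_le (hctend.comp (Filter.tendsto_add_atTop_nat 1)) hctend
      (fun n => (hZI n (hxZ n)).1.le) (fun n => (hZI n (hxZ n)).2.le)
  have hxabs : ∀ n, |x n| ∈ Z n := fun n => by
    rw [abs_of_pos (one_pos.trans (hZ1 (hxZ n)))]
    exact hxZ n
  -- The points `x n` of rank `γ n`, or their negatives, converge to the end `1`, or `-1`, of the
  -- core and witness cofinality there.
  have hfreq : ∀ (y : ℝ) (w : ℕ → ℝ), |y| ≤ 1 → (∀ n, |w n| = x n) →
      Filter.Tendsto w Filter.atTop (𝓝 y) → ∀ δ < α,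
      ∃ᶠ z in 𝓝[X] y, ¬ uIcc y z ⊆ X ∧ δ ≤ ρ z := by
    intro y w hy hw htend δ hδ
    have hwZ : ∀ n, |w n| ∈ Z n := fun n => by rw [hw]; exact hxZ n
    obtain ⟨i, hi⟩ := hcof δ hδ
    have h1 : Filter.Tendsto w Filter.atTop (𝓝[X] y) :=
      tendsto_nhdsWithin_iff.2 ⟨htend, Filter.Eventually.of_forall fun n => Or.inr ⟨n, hwZ n⟩⟩
    refine h1.frequently (Filter.Eventually.frequently ?_)
    filter_upwards [Filter.eventually_ge_atTop i] with n hn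
    refine ⟨fun h => (hZ1 (hwZ n)).not_ge (hcore' y hy _ h), ?_⟩
    rw [hρ n _ (hwZ n), hw, hxγ]
    exact hi.trans (hmono hn)
  refine ⟨X, ρ, ⟨hcompact, ?_⟩, 0, Or.inl (by simp), hρα 0 (by simp), ?_⟩
  · rintro y (hy | ⟨n, hn⟩)
    · refine ⟨?_, ?_, ?_, ?_⟩
      · by_cases h : y = 0
        · exact ⟨1, by simp [h], hcore _ hy _ (by simp)⟩
        · exact ⟨0, fun e => h e.symm, hcore _ hy _ (by simp)⟩
      · intro z hz
        rw [hρα z (hcore' y hy z hz), hρα y hy]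
      · filter_upwards [self_mem_nhdsWithin] with z hz
        rw [hρα y hy]
        by_cases h : |z| ≤ 1
        · exact Or.inl (hcore y hy z h)
        · exact Or.inr (hρlt z hz h)
      · intro hyi δ hδ
        rw [hρα y hy] at hδ
        have hy1 : |y| = 1 := by
          refine le_antisymm hy ?_
          by_contra! h
          refine hyi (mem_interior.2 ⟨{z | |z| < 1}, fun z hz => Or.inl (le_of_lt hz),
            isOpen_lt continuous_abs continuous_const, h⟩)
        have hxx : ∀ n, |x n| = x n := fun n => abs_of_pos (one_pos.trans (hZ1 (hxZ n)))
        rcases (abs_eq zero_le_one).1 hy1 with h | h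
        · exact hfreq y x hy hxx (h ▸ hxtend) δ hδ
        · exact hfreq y (fun n => -x n) hy (fun n => by rw [abs_neg, hxx]) (h ▸ hxtend.neg) δ hδ
    · rcases le_total 0 y with h0 | h0
      · have hyn : y ∈ Z n := by rwa [abs_of_nonneg h0] at hn
        refine ((hr n).rankedAt y hyn).congr hyn (hZI n hyn) (hcZ _ _) (hcZ _ _) (hcX₁ _) (hcX₁ _)
          ?_ ?_
        · ext z
          refine and_congr_left fun hz => ?_
          have hz1 : 1 < z := (hc1 _).trans hz.1
          have habs : |z| = z := abs_of_pos (one_pos.trans hz1)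
          constructor
          · exact fun h => Or.inr ⟨n, by rwa [habs]⟩
          · rintro (h | ⟨m, h⟩)
            · rw [habs] at h
              exact absurd hz1 h.not_gt
            · rw [habs] at h
              exact hinj h hz ▸ h
        · intro z hz
          have habs : |z| = z := abs_of_pos (one_pos.trans (hZ1 hz.1))
          have := hρ n z (by rw [habs]; exact hz.1)
          rw [habs] at this
          exact this.symm
      · have hyn : y ∈ Neg.neg ⁻¹' Z n := by rwa [abs_of_nonpos h0] at hn
        have hyI := hZI n hyn
        refine ((hr n).neg.rankedAt y hyn).congr hyn (s := -c n) (t := -c (n + 1))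
          ⟨by linarith [hyI.2], by linarith [hyI.1]⟩ ?_ ?_ (hcX₂ _) (hcX₂ _) ?_ ?_
        · simpa using hcZ n n
        · simpa using hcZ n (n + 1)
        · ext z
          refine and_congr_left fun hz => ?_
          have hz' : -z ∈ Ioo (c (n + 1)) (c n) := ⟨by linarith [hz.2], by linarith [hz.1]⟩
          have hz1 : 1 < -z := (hc1 _).trans hz'.1
          have habs : |z| = -z := abs_of_neg (by linarith)
          constructor
          · exact fun h => Or.inr ⟨n, by rwa [habs]⟩
          · rintro (h | ⟨m, h⟩)
            · rw [habs] at h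
              exact absurd hz1 h.not_gt
            · rw [habs] at h
              exact hinj h hz' ▸ h
        · intro z hz
          have h1 := hZ1 (mem_preimage.1 hz.1)
          have habs : |z| = -z := abs_of_neg (by linarith)
          have := hρ n z (by rw [habs]; exact hz.1)
          rw [habs] at this
          exact this.symm
  · intro y hy
    by_cases h : |y| ≤ 1
    · exact Or.inl (hcore 0 (by simp) y h)
    · exact Or.inr (hρlt y hy h)

theorem exists_hasRank {c : LimitSequences} (hc : c.IsFundamental) {α : Ordinal.{0}}
    (hα : α < Ordinal.omega 1) : ∃ Z, HasRank Z α := by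
  induction α using Ordinal.limitRecOn with
  | zero => exact ⟨_, hasRank_zero⟩
  | add_one γ ih =>
    exact exists_hasRank_of_cofinal (γ := fun _ => γ) monotone_const
      (fun _ => lt_add_one γ) (fun δ hδ => ⟨0, Order.lt_add_one_iff.1 hδ⟩)
      fun _ => ih ((lt_add_one γ).trans hα)
  | limit α hlim ih =>
    obtain ⟨h1, h2⟩ := hc α hlim hα
    exact exists_hasRank_of_cofinal (γ := fun n => (c α hlim n : Ordinal.{0}))
      (fun i j hij => h1.monotone hij) (fun n => (c α hlim n).2)
      (fun δ hδ => (h2 δ hδ).imp fun _ => le_of_lt)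
      fun n => ih _ (c α hlim n).2 ((mem_Iio.1 (c α hlim n).2).trans hα)

/-! ### Extending order isomorphisms to the line. -/

/-- A strictly increasing map between closed unbounded sets of reals extends to a homeomorphism of
the line, affine on the gaps. -/
theorem exists_homeomorph_extension {X : Set ℝ} {e : ℝ → ℝ} (hX : IsClosed X)
    (hXb : ∀ x, ∃ y ∈ X, y ≤ x) (hXa : ∀ x, ∃ y ∈ X, x ≤ y) (he : StrictMonoOn e X)
    (hY : IsClosed (e '' X)) (hYb : ∀ x, ∃ y ∈ e '' X, y ≤ x) (hYa : ∀ x, ∃ y ∈ e '' X, x ≤ y) :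
    ∃ f : ℝ ≃ₜ ℝ, EqOn f e X := by
  have floor : ∀ Z : Set ℝ, IsClosed Z → (∀ x, ∃ y ∈ Z, y ≤ x) →
      ∀ x, ∃ l, IsGreatest (Z ∩ Iic x) l := by
    intro Z hZ hb x
    obtain ⟨y, hy, hyx⟩ := hb x
    have hbd : BddAbove (Z ∩ Iic x) := ⟨x, fun z hz => hz.2⟩
    exact ⟨_, (hZ.inter isClosed_Iic).csSup_mem ⟨y, hy, hyx⟩ hbd, fun z hz => le_csSup hbd hz⟩
  have ceil : ∀ Z : Set ℝ, IsClosed Z → (∀ x, ∃ y ∈ Z, x ≤ y) →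
      ∀ x, ∃ l, IsLeast (Z ∩ Ici x) l := by
    intro Z hZ hb x
    obtain ⟨y, hy, hyx⟩ := hb x
    have hbd : BddBelow (Z ∩ Ici x) := ⟨x, fun z hz => hz.2⟩
    exact ⟨_, (hZ.inter isClosed_Ici).csInf_mem ⟨y, hy, hyx⟩ hbd, fun z hz => csInf_le hbd hz⟩
  choose l hl using floor X hX hXb
  choose r hr using ceil X hX hXa
  have hlX : ∀ x, l x ∈ X := fun x => (hl x).1.1
  have hrX : ∀ x, r x ∈ X := fun x => (hr x).1.1
  have hlx : ∀ x, l x ≤ x := fun x => (hl x).1.2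
  have hxr : ∀ x, x ≤ r x := fun x => (hr x).1.2
  have hself : ∀ x ∈ X, l x = x ∧ r x = x := fun x hx =>
    ⟨(hlx x).antisymm ((hl x).2 ⟨hx, mem_Iic.2 le_rfl⟩),
      ((hr x).2 ⟨hx, mem_Ici.2 le_rfl⟩).antisymm (hxr x)⟩
  -- Linear interpolation between the neighbours `l x` and `r x` in `X`. For `x ∈ X` they coincide
  -- and the middle term vanishes, so `f x = e x`.
  let f : ℝ → ℝ := fun x => e (l x) + (x - l x) / (r x - l x) * (e (r x) - e (l x))
  have hfX : EqOn f e X := by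
    intro x hx
    simp [f, (hself x hx).1, (hself x hx).2]
  have hgap : ∀ x y, x ∉ X → y ∈ X → x < y → f x < e y := by
    intro x y hx hy hxy
    have h1 : l x < x := lt_of_le_of_ne (hlx x) fun h => hx (h ▸ hlX x)
    have h2 : x < r x := lt_of_le_of_ne (hxr x) fun h => hx (h ▸ hrX x)
    have h3 := he (hlX x) (hrX x) (h1.trans h2)
    have h4 : (x - l x) / (r x - l x) < 1 := (div_lt_one (by linarith)).2 (by linarith)
    have h5 := mul_lt_mul_of_pos_right h4 (sub_pos.2 h3)
    have h6 : e (r x) ≤ e y := he.monotoneOn (hrX x) hy ((hr x).2 ⟨hy, hxy.le⟩)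
    simp only [f]
    linarith
  have hgap' : ∀ x y, x ∉ X → y ∈ X → y < x → e y < f x := by
    intro x y hx hy hxy
    have h1 : l x < x := lt_of_le_of_ne (hlx x) fun h => hx (h ▸ hlX x)
    have h2 : x < r x := lt_of_le_of_ne (hxr x) fun h => hx (h ▸ hrX x)
    have h3 := he (hlX x) (hrX x) (h1.trans h2)
    have h4 : 0 < (x - l x) / (r x - l x) := div_pos (by linarith) (by linarith)
    have h5 := mul_pos h4 (sub_pos.2 h3)
    have h6 : e y ≤ e (l x) := he.monotoneOn hy (hlX x) ((hl x).2 ⟨hy, hxy.le⟩)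
    simp only [f]
    linarith
  have hmono : StrictMono f := by
    intro x y hxy
    by_cases hx : x ∈ X
    · rw [hfX hx]
      by_cases hy : y ∈ X
      · rw [hfX hy]
        exact he hx hy hxy
      · exact hgap' y x hy hx hxy
    by_cases hy : y ∈ X
    · rw [hfX hy]
      exact hgap x y hx hy hxy
    -- Either a point of `X` separates `x` and `y`, or they lie in the same gap and share both
    -- neighbours.
    by_cases hz : ∃ z ∈ X, x < z ∧ z < y
    · obtain ⟨z, hz, h1, h2⟩ := hz
      exact (hgap x z hx hz h1).trans (hgap' y z hy hz h2)
    push Not at hz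
    have h1 : l x < x := lt_of_le_of_ne (hlx x) fun h => hx (h ▸ hlX x)
    have h2 : y < r y := lt_of_le_of_ne (hxr y) fun h => hy (h ▸ hrX y)
    have h3 : l y ≤ x := by
      by_contra! h
      exact absurd (hz _ (hlX y) h) (lt_of_le_of_ne (hlx y) fun h => hy (h ▸ hlX y)).not_ge
    have h4 : y ≤ r x := hz _ (hrX x) (lt_of_le_of_ne (hxr x) fun h => hx (h ▸ hrX x))
    have hll : l y = l x :=
      ((hl x).2 ⟨hlX y, h3⟩).antisymm ((hl y).2 ⟨hlX x, ((hlx x).trans hxy.le)⟩)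
    have hrr : r y = r x :=
      ((hr y).2 ⟨hrX x, h4⟩).antisymm ((hr x).2 ⟨hrX y, hxy.le.trans (hxr y)⟩)
    have h5 := he (hlX x) (hrX x) (h1.trans (hxy.trans_le h4))
    have h6 : (x - l x) / (r x - l x) < (y - l x) / (r x - l x) :=
      div_lt_div_of_pos_right (by linarith) (by linarith)
    have h7 := mul_lt_mul_of_pos_right h6 (sub_pos.2 h5)
    simp only [f, hll, hrr]
    linarith
  have hsurj : Function.Surjective f := by
    intro y
    by_cases hy : y ∈ e '' X
    · obtain ⟨x, hx, rfl⟩ := hy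
      exact ⟨x, hfX hx⟩
    -- The gap of `e '' X` around `y` comes from a gap `(u, v)` of `X`, on which the interpolation
    -- is inverted explicitly.
    obtain ⟨_, ⟨⟨u, hu, rfl⟩, huy⟩, hu'⟩ := floor _ hY hYb y
    obtain ⟨_, ⟨⟨v, hv, rfl⟩, hvy⟩, hv'⟩ := ceil _ hY hYa y
    have h1 : e u < y := lt_of_le_of_ne huy fun h => hy ⟨u, hu, h⟩
    have h2 : y < e v := lt_of_le_of_ne hvy fun h => hy ⟨v, hv, h.symm⟩
    have huv : u < v := (he.lt_iff_lt hu hv).1 (h1.trans h2)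
    have hno : ∀ z ∈ X, z ≤ u ∨ v ≤ z := by
      intro z hz
      rcases le_total (e z) y with h | h
      · exact Or.inl ((he.le_iff_le hz hu).1 (hu' ⟨⟨z, hz, rfl⟩, h⟩))
      · exact Or.inr ((he.le_iff_le hv hz).1 (hv' ⟨⟨z, hz, rfl⟩, h⟩))
    have hk0 : 0 < (y - e u) / (e v - e u) := div_pos (by linarith) (by linarith)
    have hk1 : (y - e u) / (e v - e u) < 1 := (div_lt_one (by linarith)).2 (by linarith)
    set x := u + (y - e u) / (e v - e u) * (v - u) with hx
    have hux : u < x := by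
      have := mul_pos hk0 (sub_pos.2 huv)
      linarith
    have hxv : x < v := by
      have := mul_lt_mul_of_pos_right hk1 (sub_pos.2 huv)
      linarith
    have hlu : l x = u :=
      ((hno _ (hlX x)).resolve_right fun h => absurd (hlx x) (hxv.trans_le h).not_ge).antisymm
        ((hl x).2 ⟨hu, hux.le⟩)
    have hrv : r x = v :=
      ((hr x).2 ⟨hv, hxv.le⟩).antisymm
        ((hno _ (hrX x)).resolve_left fun h => absurd (hxr x) (h.trans_lt hux).not_ge)
    refine ⟨x, ?_⟩
    have h3 : v - u ≠ 0 := by linarith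
    have h4 : e v - e u ≠ 0 := by linarith
    change e (l x) + (x - l x) / (r x - l x) * (e (r x) - e (l x)) = y
    rw [hlu, hrv, hx]
    field_simp
    ring
  exact ⟨(hmono.orderIsoOfSurjective f hsurj).toHomeomorph, hfX⟩

/-- An order isomorphism between compact sets of reals is induced by a homeomorphism of the
line. -/
theorem exists_real_homeomorph_image_eq {X Y : Set ℝ} (hX : IsCompact X) (hY : IsCompact Y)
    (hne : X.Nonempty) (e : X ≃o Y) : ∃ f : ℝ ≃ₜ ℝ, f '' X = Y := by
  classical
  obtain ⟨m, hm⟩ := hX.exists_isLeast hne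
  obtain ⟨M, hM⟩ := hX.exists_isGreatest hne
  have hmM : m ≤ M := hm.2 hM.1
  let m' : ℝ := e ⟨m, hm.1⟩
  let M' : ℝ := e ⟨M, hM.1⟩
  have hmM' : m' ≤ M' := e.monotone (show (⟨m, hm.1⟩ : X) ≤ ⟨M, hM.1⟩ from hmM)
  -- Translations beyond the extreme points make domain and image unbounded in both directions, as
  -- the extension result requires.
  let g : ℝ → ℝ := fun x =>
    if hx : x ∈ X then e ⟨x, hx⟩ else if x < m then x - m + m' else x - M + M'
  have hg : ∀ x (hx : x ∈ X), g x = e ⟨x, hx⟩ := fun x hx => dif_pos hx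
  have hgm : ∀ x, x < m → g x = x - m + m' := fun x hx => by
    simp only [g]
    rw [dif_neg fun h => (hm.2 h).not_gt hx, if_pos hx]
  have hgM : ∀ x, M < x → g x = x - M + M' := fun x hx => by
    simp only [g]
    rw [dif_neg fun h => (hM.2 h).not_gt hx, if_neg (by linarith)]
  have hgXm : ∀ x ∈ X, m' ≤ g x := fun x hx => by
    rw [hg x hx]
    exact e.monotone (show (⟨m, hm.1⟩ : X) ≤ ⟨x, hx⟩ from hm.2 hx)
  have hgXM : ∀ x ∈ X, g x ≤ M' := fun x hx => by
    rw [hg x hx]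
    exact e.monotone (show (⟨x, hx⟩ : X) ≤ ⟨M, hM.1⟩ from hM.2 hx)
  have hgX : g '' X = Y := by
    ext y
    constructor
    · rintro ⟨x, hx, rfl⟩
      rw [hg x hx]
      exact Subtype.coe_prop _
    · intro hy
      refine ⟨e.symm ⟨y, hy⟩, Subtype.coe_prop _, ?_⟩
      rw [hg _ (Subtype.coe_prop _)]
      simp
  have hgIio : g '' Iio m = Iio m' := by
    ext y
    constructor
    · rintro ⟨x, hx, rfl⟩
      rw [hgm x hx]
      simp only [mem_Iio] at hx ⊢
      linarith
    · intro hy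
      have hy' : y < m' := hy
      have hlt : y - m' + m < m := by linarith
      exact ⟨y - m' + m, hlt, by rw [hgm _ hlt]; ring⟩
  have hgIoi : g '' Ioi M = Ioi M' := by
    ext y
    constructor
    · rintro ⟨x, hx, rfl⟩
      rw [hgM x hx]
      simp only [mem_Ioi] at hx ⊢
      linarith
    · intro hy
      have hy' : M' < y := hy
      have hlt : M < y - M' + M := by linarith
      exact ⟨y - M' + M, hlt, by rw [hgM _ hlt]; ring⟩
  have hmono : StrictMonoOn g (Iio m ∪ X ∪ Ioi M) := by
    rintro x ((hx | hx) | hx) y ((hy | hy) | hy) hxy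
    · rw [hgm x hx, hgm y hy]
      linarith
    · rw [hgm x hx]
      have := hgXm y hy
      simp only [mem_Iio] at hx
      linarith
    · rw [hgm x hx, hgM y hy]
      simp only [mem_Iio, mem_Ioi] at hx hy
      linarith
    · have := hm.2 hx
      simp only [mem_Iio] at hy
      linarith
    · rw [hg x hx, hg y hy]
      exact e.strictMono (show (⟨x, hx⟩ : X) < ⟨y, hy⟩ from hxy)
    · rw [hgM y hy]
      have := hgXM x hx
      simp only [mem_Ioi] at hy
      linarith
    · simp only [mem_Iio, mem_Ioi] at hx hy
      linarith
    · have := hM.2 hy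
      simp only [mem_Ioi] at hx
      linarith
    · rw [hgM x hx, hgM y hy]
      linarith
  have hclosed : ∀ (Z : Set ℝ) (u v : ℝ), IsClosed Z → u ∈ Z → v ∈ Z →
      IsClosed (Iio u ∪ Z ∪ Ioi v) := by
    intro Z u v hZ hu hv
    have : Iio u ∪ Z ∪ Ioi v = Iic u ∪ Z ∪ Ici v := by
      ext z
      simp only [mem_union, mem_Iio, mem_Ioi, mem_Iic, mem_Ici]
      constructor
      · rintro ((h | h) | h)
        · exact Or.inl (Or.inl h.le)
        · exact Or.inl (Or.inr h)
        · exact Or.inr h.le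
      · rintro ((h | h) | h)
        · exact h.lt_or_eq.elim (fun h => Or.inl (Or.inl h)) fun h => Or.inl (Or.inr (h ▸ hu))
        · exact Or.inl (Or.inr h)
        · exact h.lt_or_eq.elim (fun h => Or.inr h) fun h => Or.inl (Or.inr (h ▸ hv))
    rw [this]
    exact (isClosed_Iic.union hZ).union isClosed_Ici
  have himage : g '' (Iio m ∪ X ∪ Ioi M) = Iio m' ∪ Y ∪ Ioi M' := by
    rw [image_union, image_union, hgX, hgIio, hgIoi]
  obtain ⟨f, hf⟩ := exists_homeomorph_extension (e := g) (hclosed X m M hX.isClosed hm.1 hM.1)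
    (fun x => ⟨min x (m - 1), Or.inl (Or.inl (by simp)), min_le_left _ _⟩)
    (fun x => ⟨max x (M + 1), Or.inr (by simp), le_max_left _ _⟩) hmono
    (himage ▸ hclosed Y m' M' hY.isClosed (Subtype.coe_prop _) (Subtype.coe_prop _))
    (himage ▸ fun x => ⟨min x (m' - 1), Or.inl (Or.inl (by simp)), min_le_left _ _⟩)
    (himage ▸ fun x => ⟨max x (M' + 1), Or.inr (by simp), le_max_left _ _⟩)
  refine ⟨f, ?_⟩
  rw [← hgX]
  exact (hf.mono fun x hx => Or.inl (Or.inr hx)).image_eq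

/-! ### The space of intervals and its derived sets. -/

theorem mem_connectedComponentIn_iff_uIcc_subset {Z : Set ℝ} {x y : ℝ} (hx : x ∈ Z) :
    y ∈ connectedComponentIn Z x ↔ uIcc x y ⊆ Z := by
  constructor
  · intro h
    exact (isPreconnected_connectedComponentIn.ordConnected.uIcc_subset
      (mem_connectedComponentIn hx) h).trans (connectedComponentIn_subset Z x)
  · intro h
    exact isPreconnected_uIcc.subset_connectedComponentIn left_mem_uIcc h right_mem_uIcc

theorem IntervalFamily.subset {Z : Set ℝ} (I : IntervalFamily Z) : I.1 ⊆ Z := by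
  obtain ⟨-, x, -, hI⟩ := I.2
  rw [hI]
  exact connectedComponentIn_subset Z x

theorem IntervalFamily.eq_connectedComponentIn {Z : Set ℝ} (I : IntervalFamily Z) {x : ℝ}
    (hx : x ∈ I.1) : I.1 = connectedComponentIn Z x := by
  obtain ⟨-, y, -, hI⟩ := I.2
  rw [hI] at hx ⊢
  exact connectedComponentIn_eq hx

theorem IntervalFamily.mem_iff {Z : Set ℝ} (I : IntervalFamily Z) {x y : ℝ} (hx : x ∈ I.1) :
    y ∈ I.1 ↔ uIcc x y ⊆ Z := by
  rw [I.eq_connectedComponentIn hx, mem_connectedComponentIn_iff_uIcc_subset (I.subset hx)]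

theorem IntervalFamily.eq_of_mem {Z : Set ℝ} {I J : IntervalFamily Z} {x : ℝ}
    (hI : x ∈ I.1) (hJ : x ∈ J.1) : I = J :=
  Subtype.ext ((I.eq_connectedComponentIn hI).trans (J.eq_connectedComponentIn hJ).symm)

theorem IntervalFamily.ordConnected {Z : Set ℝ} (I : IntervalFamily Z) : I.1.OrdConnected := by
  obtain ⟨-, y, -, hI⟩ := I.2
  rw [hI]
  exact isPreconnected_connectedComponentIn.ordConnected

/-- Distinct components are disjoint and convex, so one pair of points decides their order. -/
theorem IntervalFamily.lt_of_ne {Z : Set ℝ} {I J : IntervalFamily Z} {x y : ℝ} (hne : I ≠ J)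
    (hx : x ∈ I.1) (hy : y ∈ J.1) (hxy : x < y) : I < J := by
  intro x' hx' y' hy'
  by_contra! h
  rcases le_total y' x with h1 | h1
  · exact hne (IntervalFamily.eq_of_mem hx (J.ordConnected.out hy' hy ⟨h1, hxy.le⟩))
  · exact hne (IntervalFamily.eq_of_mem (I.ordConnected.out hx hx' ⟨h1, h⟩) hy')

theorem IntervalFamily.isOpen_Ioi {Z : Set ℝ} (I : IntervalFamily Z) : IsOpen (Ioi I) :=
  TopologicalSpace.isOpen_generateFrom_of_mem ⟨I, Or.inl rfl⟩

theorem IntervalFamily.isOpen_Iio {Z : Set ℝ} (I : IntervalFamily Z) : IsOpen (Iio I) :=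
  TopologicalSpace.isOpen_generateFrom_of_mem ⟨I, Or.inr rfl⟩

theorem IntervalFamily.eventually_ne {Z : Set ℝ} {I J : IntervalFamily Z} (h : J ≠ I) :
    ∀ᶠ K in 𝓝 I, K ≠ J := by
  obtain ⟨x, hx⟩ := I.2.1.nonempty
  obtain ⟨y, hy⟩ := J.2.1.nonempty
  rcases lt_trichotomy x y with h1 | h1 | h1
  · filter_upwards [J.isOpen_Iio.mem_nhds (IntervalFamily.lt_of_ne h.symm hx hy h1)] with K hK
      using ne_of_lt hK
  · exact absurd (IntervalFamily.eq_of_mem hy (h1 ▸ hx)) h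
  · filter_upwards [J.isOpen_Ioi.mem_nhds (IntervalFamily.lt_of_ne h hy hx h1)] with K hK
      using ne_of_gt hK

theorem IntervalFamily.infinite_of_mem_derivedSet {Z : Set ℝ} {S : Set (IntervalFamily Z)}
    {I : IntervalFamily Z} (h : I ∈ derivedSet S) : S.Infinite := by
  intro hfin
  rw [mem_derivedSet, accPt_iff_frequently] at h
  have hev : ∀ᶠ K in 𝓝 I, ∀ J ∈ S, J ≠ I → K ≠ J :=
    hfin.eventually_all.2 fun J _ => by
      by_cases hJ : J = I
      · exact Filter.Eventually.of_forall fun _ h => absurd hJ h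
      · exact (IntervalFamily.eventually_ne hJ).mono fun _ h _ => h
  obtain ⟨K, ⟨h1, h2⟩, h3⟩ := (h.and_eventually hev).exists
  exact h3 K h2 h1 rfl

/-- The value of `ρ` at some point of the interval `I`. -/
noncomputable def IntervalFamily.rank {Z : Set ℝ} (ρ : ℝ → Ordinal.{0}) (I : IntervalFamily Z) : Ordinal.{0} :=
  ρ I.2.1.nonempty.some

namespace IsRanking

variable {Z : Set ℝ} {ρ : ℝ → Ordinal.{0}}

theorem rank_eq (h : IsRanking Z ρ) {I : IntervalFamily Z} {x : ℝ} (hx : x ∈ I.1) :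
    I.rank ρ = ρ x :=
  (h.rankedAt x (I.subset hx)).const _ ((I.mem_iff hx).1 I.2.1.nonempty.some_mem)

/-- The component of a point of `Z`. -/
def component (h : IsRanking Z ρ) (x : Z) : IntervalFamily Z :=
  ⟨connectedComponentIn Z x, by
    obtain ⟨y, hne, hy⟩ := (h.rankedAt x x.2).exists_ne
    exact ⟨x, mem_connectedComponentIn x.2, y,
      (mem_connectedComponentIn_iff_uIcc_subset x.2).2 hy, hne.symm⟩, x, x.2, rfl⟩

theorem mem_component (h : IsRanking Z ρ) (x : Z) : (x : ℝ) ∈ (h.component x).1 :=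
  mem_connectedComponentIn x.2

theorem isRegularlyClosed (h : IsRanking Z ρ) : IsRegularlyClosed Z :=
  ⟨h.isCompact.isClosed, fun x hx =>
    subset_closure ⟨_, (h.component ⟨x, hx⟩).2, h.mem_component ⟨x, hx⟩⟩⟩

/-- This carries accumulation in `Z` over to the interval family. If the component of `x` lies
beyond `J`, a gap point separates them, and points of `Z` near `x` stay on the same side of it. -/
theorem continuous_component (h : IsRanking Z ρ) : Continuous h.component := by
  refine continuous_generateFrom_iff.2 ?_
  rintro _ ⟨J, rfl | rfl⟩
  · refine isOpen_iff_mem_nhds.2 fun x hx => ?_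
    obtain ⟨d, hd⟩ := J.2.1.nonempty
    have hdx : d < x := (show J < h.component x from hx) d hd x (h.mem_component x)
    have hnot : ¬ Icc d x ⊆ Z := fun hsub => lt_irrefl (x : ℝ)
      ((show J < h.component x from hx) x ((J.mem_iff hd).2 (by rwa [uIcc_of_le hdx.le])) x
        (h.mem_component x))
    obtain ⟨t, ht, htZ⟩ := not_subset.1 hnot
    have htx : t < x := lt_of_le_of_ne ht.2 fun e => htZ (e ▸ x.2)
    filter_upwards [(isOpen_lt continuous_const continuous_subtype_val).mem_nhds htx] with y hy
    refine IntervalFamily.lt_of_ne (fun e => htZ ?_) hd (h.mem_component y) (ht.1.trans_lt hy)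
    exact (J.mem_iff hd).1 (e ▸ h.mem_component y) (mem_uIcc.2 (Or.inl ⟨ht.1, le_of_lt hy⟩))
  · refine isOpen_iff_mem_nhds.2 fun x hx => ?_
    obtain ⟨d, hd⟩ := J.2.1.nonempty
    have hdx : x < d := (show h.component x < J from hx) x (h.mem_component x) d hd
    have hnot : ¬ Icc (x : ℝ) d ⊆ Z := fun hsub => lt_irrefl (x : ℝ)
      ((show h.component x < J from hx) x (h.mem_component x) x
        ((J.mem_iff hd).2 (by rwa [uIcc_of_ge hdx.le])))
    obtain ⟨t, ht, htZ⟩ := not_subset.1 hnot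
    have htx : x < t := lt_of_le_of_ne ht.1 fun e => htZ (e ▸ x.2)
    filter_upwards [(isOpen_lt continuous_subtype_val continuous_const).mem_nhds htx] with y hy
    refine IntervalFamily.lt_of_ne (fun e => htZ ?_) (h.mem_component y) hd (hy.trans_le ht.2)
    exact (J.mem_iff hd).1 (e ▸ h.mem_component y) (mem_uIcc.2 (Or.inr ⟨le_of_lt hy, ht.2⟩))

theorem exists_left_end_mem (h : IsRanking Z ρ) (I : IntervalFamily Z) :
    ∃ a ∈ I.1, ∀ u < a, ∃ t ∈ Ioo u a, t ∉ Z := by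
  obtain ⟨x, hx⟩ := I.2.1.nonempty
  obtain ⟨a, hax, hsub, ha⟩ := exists_left_end h.isCompact (I.subset hx)
  exact ⟨a, (I.mem_iff hx).2 (by rwa [uIcc_of_ge hax]), ha⟩

theorem exists_right_end_mem (h : IsRanking Z ρ) (I : IntervalFamily Z) :
    ∃ a ∈ I.1, ∀ u > a, ∃ t ∈ Ioo a u, t ∉ Z := by
  obtain ⟨x, hx⟩ := I.2.1.nonempty
  obtain ⟨a, hax, hsub, ha⟩ := exists_right_end h.isCompact (I.subset hx)
  exact ⟨a, (I.mem_iff hx).2 (by rwa [uIcc_of_le hax]), ha⟩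

/-- The components accumulating at the left end of `I`, provided by `approx`, accumulate at `I` in
the order topology by continuity of `component`. -/
theorem mem_derivedSet_of_lt_rank (h : IsRanking Z ρ) {I : IntervalFamily Z} {β : Ordinal.{0}}
    (hβ : β < I.rank ρ) : I ∈ derivedSet {J : IntervalFamily Z | β ≤ J.rank ρ} := by
  obtain ⟨a, haI, ha⟩ := h.exists_left_end_mem I
  have haZ := I.subset haI
  have hfr := (h.rankedAt a haZ).approx (notMem_interior_of_left_end ha) β (h.rank_eq haI ▸ hβ)
  rw [nhdsWithin_eq_map_subtype_coe haZ, Filter.frequently_map] at hfr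
  have hI : h.component ⟨a, haZ⟩ = I := IntervalFamily.eq_of_mem (h.mem_component ⟨a, haZ⟩) haI
  have ht : Filter.Tendsto h.component (𝓝 ⟨a, haZ⟩) (𝓝 I) :=
    hI ▸ h.continuous_component.tendsto ⟨a, haZ⟩
  rw [mem_derivedSet, accPt_iff_frequently]
  refine ht.frequently (hfr.mono ?_)
  rintro y ⟨h1, h2⟩
  refine ⟨fun e => h1 ((I.mem_iff haI).1 (e ▸ h.mem_component y)), ?_⟩
  rwa [mem_ofPred_eq, h.rank_eq (h.mem_component y)]

theorem eventually_rank_lt_left (h : IsRanking Z ρ) (I : IntervalFamily Z) :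
    ∀ᶠ J in 𝓝 I, J < I → J.rank ρ < I.rank ρ := by
  obtain ⟨a, haI, ha⟩ := h.exists_left_end_mem I
  have haZ := I.subset haI
  have hev := (h.rankedAt a haZ).lt_near
  rw [nhdsWithin, Filter.eventually_inf_principal, Metric.eventually_nhds_iff] at hev
  obtain ⟨ε, hε, hev⟩ := hev
  obtain ⟨s, hs, hsZ⟩ := ha (a - ε) (by linarith)
  have hnear : ∀ (J : IntervalFamily Z) (y : ℝ), y ∈ J.1 → s < y → J < I →
      J.rank ρ < I.rank ρ := by
    intro J y hy hsy hJI
    have hya := hJI y hy a haI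
    have hd : dist y a < ε := by
      rw [Real.dist_eq, abs_of_neg (by linarith)]
      linarith [hs.1]
    rw [h.rank_eq hy, h.rank_eq haI]
    refine (hev hd (J.subset hy)).resolve_left fun h1 => ?_
    exact lt_irrefl y (hJI y hy y ((I.mem_iff haI).2 h1))
  -- An order neighbourhood of `I` needs a bounding interval: the component of the last point of `Z`
  -- before the gap `s`. If there is no such point, no bound is needed.
  rcases (Z ∩ Iic s).eq_empty_or_nonempty with hem | hne
  · refine Filter.Eventually.of_forall fun J hJ => ?_
    obtain ⟨y, hy⟩ := J.2.1.nonempty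
    exact hnear J y hy (not_le.1 fun hys => hem.le ⟨J.subset hy, hys⟩) hJ
  · obtain ⟨z, hz, hzmax⟩ := (h.isCompact.inter_right isClosed_Iic).exists_isGreatest hne
    have hzI : h.component ⟨z, hz.1⟩ < I := by
      refine IntervalFamily.lt_of_ne (fun e => hsZ ?_) (h.mem_component ⟨z, hz.1⟩) haI
        (lt_of_le_of_lt hz.2 hs.2)
      have hzI : z ∈ I.1 := e ▸ h.mem_component ⟨z, hz.1⟩
      exact I.subset (I.ordConnected.out hzI haI ⟨hz.2, hs.2.le⟩)
    filter_upwards [(h.component ⟨z, hz.1⟩).isOpen_Ioi.mem_nhds hzI] with J hJ hJI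
    obtain ⟨y, hy⟩ := J.2.1.nonempty
    refine hnear J y hy (not_le.1 fun hys => ?_) hJI
    have h1 : z < y := (show h.component ⟨z, hz.1⟩ < J from hJ) z (h.mem_component ⟨z, hz.1⟩) y hy
    exact absurd (hzmax ⟨J.subset hy, hys⟩) h1.not_ge

theorem eventually_rank_lt_right (h : IsRanking Z ρ) (I : IntervalFamily Z) :
    ∀ᶠ J in 𝓝 I, I < J → J.rank ρ < I.rank ρ := by
  obtain ⟨a, haI, ha⟩ := h.exists_right_end_mem I
  have haZ := I.subset haI
  have hev := (h.rankedAt a haZ).lt_near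
  rw [nhdsWithin, Filter.eventually_inf_principal, Metric.eventually_nhds_iff] at hev
  obtain ⟨ε, hε, hev⟩ := hev
  obtain ⟨s, hs, hsZ⟩ := ha (a + ε) (by linarith)
  have hnear : ∀ (J : IntervalFamily Z) (y : ℝ), y ∈ J.1 → y < s → I < J →
      J.rank ρ < I.rank ρ := by
    intro J y hy hsy hJI
    have hya := hJI a haI y hy
    have hd : dist y a < ε := by
      rw [Real.dist_eq, abs_of_pos (by linarith)]
      linarith [hs.2]
    rw [h.rank_eq hy, h.rank_eq haI]
    refine (hev hd (J.subset hy)).resolve_left fun h1 => ?_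
    exact lt_irrefl y (hJI y ((I.mem_iff haI).2 h1) y hy)
  rcases (Z ∩ Ici s).eq_empty_or_nonempty with hem | hne
  · refine Filter.Eventually.of_forall fun J hJ => ?_
    obtain ⟨y, hy⟩ := J.2.1.nonempty
    exact hnear J y hy (not_le.1 fun hys => hem.le ⟨J.subset hy, hys⟩) hJ
  · obtain ⟨z, hz, hzmin⟩ := (h.isCompact.inter_right isClosed_Ici).exists_isLeast hne
    have hzI : I < h.component ⟨z, hz.1⟩ := by
      refine IntervalFamily.lt_of_ne (fun e => hsZ ?_) haI (h.mem_component ⟨z, hz.1⟩)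
        (lt_of_lt_of_le hs.1 hz.2)
      have hzI : z ∈ I.1 := e ▸ h.mem_component ⟨z, hz.1⟩
      exact I.subset (I.ordConnected.out haI hzI ⟨hs.1.le, hz.2⟩)
    filter_upwards [(h.component ⟨z, hz.1⟩).isOpen_Iio.mem_nhds hzI] with J hJ hJI
    obtain ⟨y, hy⟩ := J.2.1.nonempty
    refine hnear J y hy (not_le.1 fun hys => ?_) hJI
    have h1 : y < z := (show J < h.component ⟨z, hz.1⟩ from hJ) y hy z (h.mem_component ⟨z, hz.1⟩)
    exact absurd (hzmin ⟨J.subset hy, hys⟩) h1.not_ge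

theorem eventually_rank_lt (h : IsRanking Z ρ) (I : IntervalFamily Z) :
    ∀ᶠ J in 𝓝 I, J ≠ I → J.rank ρ < I.rank ρ := by
  filter_upwards [h.eventually_rank_lt_left I, h.eventually_rank_lt_right I] with J h1 h2 hne
  obtain ⟨x, hx⟩ := I.2.1.nonempty
  obtain ⟨y, hy⟩ := J.2.1.nonempty
  rcases lt_trichotomy x y with h3 | h3 | h3
  · exact h2 (IntervalFamily.lt_of_ne hne.symm hx hy h3)
  · exact absurd (IntervalFamily.eq_of_mem hy (h3 ▸ hx)) hne
  · exact h1 (IntervalFamily.lt_of_ne hne hy hx h3)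

theorem derivedSet_setOf_le_rank (h : IsRanking Z ρ) (β : Ordinal.{0}) :
    derivedSet {J : IntervalFamily Z | β ≤ J.rank ρ} = {J | β < J.rank ρ} := by
  refine Subset.antisymm (fun I hI => ?_) fun I hI => h.mem_derivedSet_of_lt_rank hI
  rw [mem_derivedSet, accPt_iff_frequently] at hI
  -- An interval of rank at least `β` close to `I` but different from it has smaller rank than `I`.
  obtain ⟨J, ⟨h1, h2⟩, h3⟩ := (hI.and_eventually (h.eventually_rank_lt I)).exists
  exact lt_of_le_of_lt h2 (h3 h1)

/-- The derived sets of the family of intervals consist of the intervals of large rank. -/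
theorem intervalDerivative_eq (h : IsRanking Z ρ) (β : Ordinal.{0}) :
    intervalDerivative Z β = {J | β ≤ J.rank ρ} := by
  induction β using Ordinal.limitRecOn with
  | zero =>
    have : intervalDerivative Z 0 = univ := by
      rw [intervalDerivative, iteratedDerivedSet, Ordinal.limitRecOn_zero]
    simp [this]
  | add_one β ih =>
    have : intervalDerivative Z (β + 1) = derivedSet (intervalDerivative Z β) := by
      rw [intervalDerivative, iteratedDerivedSet, Ordinal.limitRecOn_add_one]
      rfl
    rw [this, ih, h.derivedSet_setOf_le_rank]
    simp only [Order.add_one_le_iff]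
  | limit β hlim ih =>
    have : intervalDerivative Z β = ⋂ γ : Iio β, intervalDerivative Z γ := by
      rw [intervalDerivative, iteratedDerivedSet, Ordinal.limitRecOn_limit _ _ _ _ hlim]
      rfl
    rw [this]
    ext J
    simp only [mem_iInter, mem_ofPred_eq]
    constructor
    · intro hJ
      refine hlim.le_iff_forall_le.2 fun γ hγ => ?_
      have := hJ ⟨γ, hγ⟩
      rwa [ih γ hγ] at this
    · rintro hJ ⟨γ, hγ⟩
      rw [ih γ hγ]
      exact le_trans (le_of_lt hγ) hJ

end IsRanking

/-! ### Consequences of having a rank. -/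

theorem HasRank.isRegularlyClosed {Z : Set ℝ} {α : Ordinal.{0}} (h : HasRank Z α) :
    IsRegularlyClosed Z := by
  obtain ⟨ρ, hρ, -⟩ := h
  exact hρ.isRegularlyClosed

theorem HasRank.intervalDerivative_self {Z : Set ℝ} {α : Ordinal.{0}} (h : HasRank Z α) :
    ∃ I, intervalDerivative Z α = {I} := by
  obtain ⟨ρ, hρ, x, hx, hxα, hlt⟩ := h
  refine ⟨hρ.component ⟨x, hx⟩, ?_⟩
  rw [hρ.intervalDerivative_eq]
  ext J
  constructor
  · intro hJ
    obtain ⟨y, hy⟩ := J.2.1.nonempty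
    rw [mem_ofPred_eq, hρ.rank_eq hy] at hJ
    have := (hlt y (J.subset hy)).resolve_right hJ.not_gt
    exact IntervalFamily.eq_of_mem hy
      (((hρ.component ⟨x, hx⟩).mem_iff (hρ.mem_component ⟨x, hx⟩)).2 this)
  · rintro rfl
    rw [mem_ofPred_eq, hρ.rank_eq (hρ.mem_component ⟨x, hx⟩), hxα]

theorem HasRank.infinite_intervalDerivative {Z : Set ℝ} {α β : Ordinal.{0}} (h : HasRank Z α)
    (hβ : β < α) : (intervalDerivative Z β).Infinite := by
  obtain ⟨ρ, hρ, x, hx, hxα, hlt⟩ := h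
  rw [hρ.intervalDerivative_eq]
  refine IntervalFamily.infinite_of_mem_derivedSet (I := hρ.component ⟨x, hx⟩)
    (hρ.mem_derivedSet_of_lt_rank ?_)
  rwa [hρ.rank_eq (hρ.mem_component ⟨x, hx⟩), hxα]

/-- For `α < β` the `α`-th derivative would be both a singleton and infinite. -/
theorem HasRank.unique {Z : Set ℝ} {α β : Ordinal.{0}} (hα : HasRank Z α) (hβ : HasRank Z β) :
    α = β := by
  wlog hlt : α < β generalizing α β
  · rcases lt_trichotomy α β with h | h | h
    · exact absurd h hlt
    · exact h
    · exact (this hβ hα h).symm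
  obtain ⟨I, hI⟩ := hα.intervalDerivative_self
  have := hβ.infinite_intervalDerivative hlt
  rw [hI] at this
  exact absurd (finite_singleton I) this

theorem HasRank.nonempty {Z : Set ℝ} {α : Ordinal.{0}} (h : HasRank Z α) : Z.Nonempty := by
  obtain ⟨_, _, x, hx, _⟩ := h
  exact ⟨x, hx⟩

theorem HasRank.isBoldX {c : LimitSequences} (hc : c.IsFundamental) {α : Ordinal.{0}}
    (hα : α < Ordinal.omega 1) {X : Set ℝ} (h : HasRank X α) : IsBoldX c α X :=
  ⟨h.isCompact, h.nonempty_orderIso_iteratedS hc hα⟩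

/-- A model of rank `α` is order isomorphic to `S_α`, hence to `X`; being compact, it is carried
onto `X` by a homeomorphism of the line, which transports the rank. -/
theorem IsBoldX.hasRank {c : LimitSequences} (hc : c.IsFundamental) {α : Ordinal.{0}}
    (hα : α < Ordinal.omega 1) {X : Set ℝ} (h : IsBoldX c α X) : HasRank X α := by
  obtain ⟨Z, hZ⟩ := exists_hasRank hc hα
  obtain ⟨e⟩ := hZ.nonempty_orderIso_iteratedS hc hα
  obtain ⟨e'⟩ := h.2
  obtain ⟨f, rfl⟩ := exists_real_homeomorph_image_eq hZ.isCompact h.1 hZ.nonempty (e.trans e'.symm)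
  exact hZ.image_homeomorph f

theorem HasRank.isTameInReal {c : LimitSequences} (hc : c.IsFundamental) {α : Ordinal.{0}}
    (hα : α < Ordinal.omega 1) {X : Set ℝ} (h : HasRank X α) : IsTameInReal X := by
  rintro Y ⟨e⟩
  have hY := h.of_homeomorph e
  obtain ⟨e₁⟩ := h.nonempty_orderIso_iteratedS hc hα
  obtain ⟨e₂⟩ := hY.nonempty_orderIso_iteratedS hc hα
  exact exists_real_homeomorph_image_eq h.isCompact hY.isCompact h.nonempty (e₁.trans e₂.symm)

/-! ### Fundamental sequences and conclusion. -/

theorem exists_strictMono_cofinal {α : Ordinal.{0}} (hα : Order.IsSuccLimit α)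
    (hlt : α < Ordinal.omega 1) :
    ∃ s : ℕ → Iio α, StrictMono s ∧ ∀ β < α, ∃ n, β < (s n : Ordinal.{0}) := by
  have hcount : (Iio α).Countable := by
    rw [← Cardinal.le_aleph0_iff_set_countable, Cardinal.mk_Iio_ordinal, Cardinal.lift_le_aleph0,
      ← Cardinal.lt_aleph_one_iff, ← Cardinal.lt_ord, Cardinal.ord_aleph]
    exact hlt
  have := hcount.to_subtype
  have : Nonempty (Iio α) := ⟨⟨0, hα.bot_lt⟩⟩
  obtain ⟨g, hg⟩ := exists_surjective_nat (Iio α)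
  let next : Iio α → Iio α := fun β => ⟨Order.succ β.1, hα.succ_lt β.2⟩
  have hnext : ∀ β, β < next β := fun β => Order.lt_succ β.1
  -- Each term exceeds its predecessor and the corresponding term of an enumeration `g` of all
  -- smaller ordinals.
  let s : ℕ → Iio α := fun n => Nat.rec (g 0) (fun n β => next (max β (g n))) n
  have hs : ∀ n, s (n + 1) = next (max (s n) (g n)) := fun n => rfl
  refine ⟨s, strictMono_nat_of_lt_succ fun n => ?_, fun β hβ => ?_⟩
  · rw [hs]
    exact (le_max_left _ _).trans_lt (hnext _)
  · obtain ⟨n, hn⟩ := hg ⟨β, hβ⟩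
    refine ⟨n + 1, ?_⟩
    have h1 : g n < s (n + 1) := by
      rw [hs]
      exact (le_max_right _ _).trans_lt (hnext _)
    rw [hn] at h1
    exact h1

theorem exists_isFundamental : ∃ c : LimitSequences, c.IsFundamental := by
  have key : ∀ (α : Ordinal.{0}) (_ : Order.IsSuccLimit α), ∃ s : ℕ → Iio α,
      α < Ordinal.omega 1 → StrictMono s ∧ ∀ β < α, ∃ n, β < (s n : Ordinal.{0}) := by
    intro α hα
    by_cases h : α < Ordinal.omega 1
    · exact (exists_strictMono_cofinal hα h).imp fun s hs _ => hs
    -- A dummy sequence: nothing is required at uncountable limits.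
    · exact ⟨fun _ => ⟨0, hα.bot_lt⟩, fun h' => absurd h' h⟩
  choose c hc using key
  exact ⟨c, hc⟩

theorem corollaryc24 :
    (∃ F : Set (Set ℝ),
      Cardinal.aleph 1 ≤ Cardinal.mk F ∧
      (∀ A ∈ F, IsTameInReal A ∧ IsRegularlyClosed A ∧ IsCompact A) ∧
      (∀ A ∈ F, ∀ B ∈ F, A ≠ B → ¬ Nonempty (A ≃ₜ B))) ∧
    (∃ c : LimitSequences, c.IsFundamental) ∧
    (∀ c : LimitSequences, c.IsFundamental →
      (∀ α : Ordinal.{0}, α < Ordinal.omega 1 → ∃ X : Set ℝ, IsBoldX c α X) ∧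
      (∀ α : Ordinal.{0}, α < Ordinal.omega 1 → ∀ X : Set ℝ, IsBoldX c α X →
        IsTameInReal X ∧ IsRegularlyClosed X ∧ IsCompact X ∧
        (∃ I, intervalDerivative X α = {I}) ∧
        (∀ β < α, (intervalDerivative X β).Infinite)) ∧
      (∀ α β : Ordinal.{0}, α < Ordinal.omega 1 → β < Ordinal.omega 1 → α ≠ β →
        ∀ X Y : Set ℝ, IsBoldX c α X → IsBoldX c β Y → ¬ Nonempty (X ≃ₜ Y))) := by
  refine ⟨?_, exists_isFundamental, fun c hc => ⟨fun α hα => ?_, fun α hα X hX => ?_,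
    fun α β hα hβ hne X Y hX hY => ?_⟩⟩
  · obtain ⟨c, hc⟩ := exists_isFundamental
    choose X hX using fun α : Iio (Ordinal.omega.{0} 1) => exists_hasRank hc α.2
    have hXX : ∀ α β, Nonempty (X α ≃ₜ X β) → α = β := by
      rintro α β ⟨e⟩
      exact Subtype.ext (((hX α).of_homeomorph e).unique (hX β))
    have hinj : Function.Injective X := fun α β h => hXX α β ⟨Homeomorph.setCongr h⟩
    refine ⟨range X, ?_, ?_, ?_⟩
    · have := Cardinal.mk_range_eq_of_injective hinj
      -- The index set of ordinals lives one universe above the sets of reals, so the cardinalities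
      -- are compared after lifting.
      rw [Cardinal.mk_Iio_ordinal, Ordinal.card_omega] at this
      simp only [Cardinal.lift_lift] at this
      exact (Cardinal.lift_inj.1 this).ge
    · rintro _ ⟨α, rfl⟩
      exact ⟨(hX α).isTameInReal hc α.2, (hX α).isRegularlyClosed, (hX α).isCompact⟩
    · rintro _ ⟨α, rfl⟩ _ ⟨β, rfl⟩ hne h
      exact hne (congrArg X (hXX α β h))
  · exact (exists_hasRank hc hα).imp fun X hX => hX.isBoldX hc hα
  · have h := hX.hasRank hc hα
    exact ⟨h.isTameInReal hc hα, h.isRegularlyClosed, h.isCompact, h.intervalDerivative_self,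
      fun β hβ => h.infinite_intervalDerivative hβ⟩
  · rintro ⟨e⟩
    exact hne (((hX.hasRank hc hα).of_homeomorph e).unique (hY.hasRank hc hβ))
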